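/- Setting. Let $U,A,Z,W$ be random variables with values in standard Borel spaces $\mathcal U,\mathcal A,\mathcal Z,\mathcal W$ and let $Y$ be a real random variable, all on one (standard Borel) probability space: $A$ is the treatment, $Y$ the outcome, $U$ an unobserved confounder, $Z$ and $W$ the treatment- and the outcome-inducing proxy. Assume $Y\perp Z\mid (A,U)$ and $W\perp (A,Z)\mid U$, and that $Z$ is complete, at every treatment level, for the confounder and for the outcome-inducing proxy: for $X=U$ and for $X=W$, if $l:\mathcal A\times\mathcal X\to\mathbb R$ is square integrable (for $P_A\otimes P_X$ and for $P_{A,X}$) and $\mathbb E[l(a,X)\mid A=a,Z=z]=0$ for almost all $(a,z)$, then $l=0$ $P_A\otimes P_X$-almost everywhere. The structural function is $f_{\mathrm{struct}}(a)=\mathbb E_U[\mathbb E[Y\mid A=a,U]]$. Let $h^*$ be a bridge function: $h^*(A,W)\in L^2$ and $\mathbb E[Y\mid A,Z]=\mathbb E[h^*(A,W)\mid A,Z]$ almost surely. Model. Let $\phi_{\theta_{A(1)}},\phi_{\theta_Z},\psi_{\theta_{A(2)}},\psi_{\theta_W}$ be measurable parametrized feature maps with values in finite-dimensional Euclidean spaces,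 let $\Theta_1$ be the set of admissible stage-1 parameters $(V,\theta_{A(1)},\theta_Z)$ and $\Theta_2$ the set of admissible stage-2 parameters $(u,\theta_{A(2)},\theta_W)$. The bridge function is modelled by $h(a,w)=u^\top(\psi_{\theta_{A(2)}}(a)\otimes\psi_{\theta_W}(w))$, and $\mathbb E[\psi_{\theta_W}(W)\mid A=a,Z=z]$ by $V(\phi_{\theta_{A(1)}}(a)\otimes\phi_{\theta_Z}(z))$. Both classes are pointwise separable (a countable subset of the admissible parameters approximates pointwise, along sequences, the functions of all of them; this holds for networks that are continuous in Euclidean parameters). Boundedness. For a constant $M$: $|Y|\le M$ almost surely, and for all admissible parameters, all $a,z,w$ and all vectors $v$ with $\|v\|\le1$: $\|V(\phi_{\theta_{A(1)}}(a)\otimes\phi_{\theta_Z}(z))\|\le M$, $\|\psi_{\theta_W}(w)\|\le M$ and $|u^\top(\psi_{\theta_{A(2)}}(a)\otimes v)|\le M$. Support. $P_A\otimes P_W$ is absolutely continuous with respect to $P_{A,W}$ with density at most $\eta<\infty$. Data and estimator. Let $S_1=\{(w_i,a_i,z_i)\}_{i\le m}$ and $S_2=\{(\tilde y_i,\tilde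 a_i,\tilde z_i)\}_{i\le n}$ be i.i.d. samples of $(W,A,Z)$ and $(Y,A,Z)$ (not necessarily independent of each other), and let $S_W=\{w_i^{\mathrm{extra}}\}_{i\le n_W}$ be an i.i.d. sample of $W$ that is independent of $(S_1,S_2)$, with $m,n,n_W\ge1$. Let $\lambda_1,\lambda_2\ge0$ (possibly $0$, possibly depending on the sample sizes) satisfy $\lambda_1\|V\|^2\le\Lambda/\sqrt m$ and $\lambda_2\|u\|^2\le\Lambda/\sqrt n$ for all admissible parameters. For every admissible $\theta_W$ let $(\hat V,\hat\theta_{A(1)},\hat\theta_Z)=(\hat V,\hat\theta_{A(1)},\hat\theta_Z)(\theta_W)$ minimize over $\Theta_1$ $$\hat{\mathcal L}_1=\frac1m\sum_{i=1}^m\big\|\psi_{\theta_W}(w_i)-V(\phi_{\theta_{A(1)}}(a_i)\otimes\phi_{\theta_Z}(z_i))\big\|^2+\lambda_1\|V\|^2 ,$$ let $(\hat u,\hat\theta_{A(2)},\hat\theta_W)$, a function of $(S_1,S_2)$ that makes the estimated bridge function jointly measurable in the data and in $(a,w)$, minimize over $\Theta_2$ $$\hat{\mathcal L}_2=\frac1n\sum_{i=1}^n\Big(\tilde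 y_i-u^\top\big(\psi_{\theta_{A(2)}}(\tilde a_i)\otimes\hat V(\phi_{\hat\theta_{A(1)}}(\tilde a_i)\otimes\phi_{\hat\theta_Z}(\tilde z_i))\big)\Big)^2+\lambda_2\|u\|^2 ,$$ where $(\hat V,\hat\theta_{A(1)},\hat\theta_Z)$ is the stage-1 minimizer for the parameter $\theta_W$, and put $\hat f_{\mathrm{struct}}(a)=\hat u^\top\big(\psi_{\hat\theta_{A(2)}}(a)\otimes\frac1{n_W}\sum_{i=1}^{n_W}\psi_{\hat\theta_W}(w_i^{\mathrm{extra}})\big)$. Quantities in the bound. Let $$\mathcal H_1=\{(w,a,z)\mapsto\|\psi_{\theta_W}(w)-V(\phi_{\theta_{A(1)}}(a)\otimes\phi_{\theta_Z}(z))\|^2\},$$ $$\mathcal H_2=\{(y,a,z)\mapsto(y-u^\top(\psi_{\theta_{A(2)}}(a)\otimes V(\phi_{\theta_{A(1)}}(a)\otimes\phi_{\theta_Z}(z))))^2\},$$ over all admissible parameters, let $\hat{\mathfrak R}_S(\mathcal H)=\mathbb E_\sigma\sup_{g\in\mathcal H}\frac1k\sum_{i=1}^k\sigma_ig(s_i)$,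 with independent uniform signs $\sigma_i$, be the empirical Rademacher complexity on a sample $S=(s_1,\dots,s_k)$, let $$\kappa_1=\sup_{\theta_W}\inf_{V,\theta_{A(1)},\theta_Z}\mathbb E\big\|\mathbb E[\psi_{\theta_W}(W)\mid A,Z]-V(\phi_{\theta_{A(1)}}(A)\otimes\phi_{\theta_Z}(Z))\big\|^2,$$ $$\kappa_2=\inf_{u,\theta_{A(2)},\theta_W}\big\|\mathbb E[Y\mid A,Z]-\mathbb E[h(A,W)\mid A,Z]\big\|_{L^2},$$ and let $$\tau=\sup_{h}\frac{\|h-h^*\|_{L^2(P_{A,W})}}{\|\mathbb E[(h-h^*)(A,W)\mid A,Z]\|_{L^2}}\in[0,\infty],$$ over the bridge functions $h$ of the model (with $0/0=0$ and $c/0=\infty$ for $c>0$), be the measure of ill-posedness of the bridge equation. Claim. For every $\delta>0$ there is a constant $C$, which depends only on $M$, $\eta$, $\Lambda$ and $\delta$ (the underlying spaces being fixed), such that in every such situation and for all $m,n,n_W\ge 1$, with probability at least $1-\delta$, $$\|f_{\mathrm{struct}}-\hat f_{\mathrm{struct}}\|_{L^2(P_A)}\le C\left(\tau\left(\sqrt{\kappa_1+\hat{\mathfrak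 R}_{S_1}(\mathcal H_1)+\frac1{\sqrt m}}+\kappa_2+\sqrt{\hat{\mathfrak R}_{S_2}(\mathcal H_2)+\frac1{\sqrt n}}\right)+\frac1{\sqrt{n_W}}\right).$$ In particular, if $\tau<\infty$, then $$\|f_{\mathrm{struct}}-\hat f_{\mathrm{struct}}\|_{L^2(P_A)}\le O_p\left(\sqrt{\kappa_1+\hat{\mathfrak R}_{S_1}(\mathcal H_1)+\frac1{\sqrt m}}+\kappa_2+\sqrt{\hat{\mathfrak R}_{S_2}(\mathcal H_2)+\frac1{\sqrt n}}+\frac1{\sqrt{n_W}}\right).$$ -/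

import Mathlib

open MeasureTheory ProbabilityTheory Filter Topology
open scoped ENNReal

namespace DFPV

/-- The population: a treatment `A`, proxies `Z` (treatment-inducing) and `W` (outcome-inducing),
a real outcome `Y` and an unobserved confounder `U` on a probability space. -/
structure Population (Ω 𝒰 𝒜 𝒵 𝒲 : Type*) [MeasurableSpace Ω] [MeasurableSpace 𝒰]
    [MeasurableSpace 𝒜] [MeasurableSpace 𝒵] [MeasurableSpace 𝒲] where
  μ : Measure Ω
  isProb : IsProbabilityMeasure μ
  U : Ω → 𝒰
  A : Ω → 𝒜
  Z : Ω → 𝒵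
  W : Ω → 𝒲
  Y : Ω → ℝ
  measU : Measurable U
  measA : Measurable A
  measZ : Measurable Z
  measW : Measurable W
  measY : Measurable Y

namespace Population

variable {Ω 𝒰 𝒜 𝒵 𝒲 : Type*} [MeasurableSpace Ω] [MeasurableSpace 𝒰]
    [MeasurableSpace 𝒜] [MeasurableSpace 𝒵] [MeasurableSpace 𝒲]

instance (P : Population Ω 𝒰 𝒜 𝒵 𝒲) : IsProbabilityMeasure P.μ := P.isProb

/-- The law of `A`. -/
noncomputable def lawA (P : Population Ω 𝒰 𝒜 𝒵 𝒲) : Measure 𝒜 := P.μ.map P.A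

/-- The law of `U`. -/
noncomputable def lawU (P : Population Ω 𝒰 𝒜 𝒵 𝒲) : Measure 𝒰 := P.μ.map P.U

/-- The law of `W`. -/
noncomputable def lawW (P : Population Ω 𝒰 𝒜 𝒵 𝒲) : Measure 𝒲 := P.μ.map P.W

/-- The joint law of `(A, W)`. -/
noncomputable def lawAW (P : Population Ω 𝒰 𝒜 𝒵 𝒲) : Measure (𝒜 × 𝒲) :=
  P.μ.map (fun ω => (P.A ω, P.W ω))

/-- The law of one stage 1 observation `(W, A, Z)`. -/
noncomputable def lawWAZ (P : Population Ω 𝒰 𝒜 𝒵 𝒲) : Measure (𝒲 × 𝒜 × 𝒵) :=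
  P.μ.map (fun ω => (P.W ω, P.A ω, P.Z ω))

/-- The law of one stage 2 observation `(Y, A, Z)`. -/
noncomputable def lawYAZ (P : Population Ω 𝒰 𝒜 𝒵 𝒲) : Measure (ℝ × 𝒜 × 𝒵) :=
  P.μ.map (fun ω => (P.Y ω, P.A ω, P.Z ω))

/-- The conditional expectation `E[f | A, Z]`, as a random variable. -/
noncomputable def condAZ (P : Population Ω 𝒰 𝒜 𝒵 𝒲) (f : Ω → ℝ) : Ω → ℝ :=
  P.μ[f | MeasurableSpace.comap (fun ω => (P.A ω, P.Z ω)) inferInstance]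

/-- The structural function `f_struct(a) = E_U[ E[Y | A = a, U] ]`. -/
noncomputable def fStruct (P : Population Ω 𝒰 𝒜 𝒵 𝒲) (a : 𝒜) : ℝ :=
  ∫ u, (∫ y, y ∂(condDistrib P.Y (fun ω => (P.A ω, P.U ω)) P.μ (a, u))) ∂P.lawU

/-- The structural assumption: `Y ⫫ Z | (A, U)` and `W ⫫ (A, Z) | U`. -/
def Structural [StandardBorelSpace Ω] (P : Population Ω 𝒰 𝒜 𝒵 𝒲) : Prop :=
  CondIndepFun (MeasurableSpace.comap (fun ω => (P.A ω, P.U ω)) inferInstance)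
      (P.measA.prodMk P.measU).comap_le P.Y P.Z P.μ ∧
    CondIndepFun (MeasurableSpace.comap P.U inferInstance)
      P.measU.comap_le P.W (fun ω => (P.A ω, P.Z ω)) P.μ

/-- Completeness of `Z` for a variable `X`, at every treatment level: if
`E[l(a, X) | A = a, Z = z] = 0` for (almost) all `(a, z)`, then, for almost every `a`,
`l(a, ·) = 0` almost everywhere for the law of `X`. (For `l` depending on `X` only, the converse
implication is automatic.) -/
def CompleteFor {χ : Type*} [MeasurableSpace χ] (P : Population Ω 𝒰 𝒜 𝒵 𝒲) (X : Ω → χ) : Prop :=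
  ∀ l : 𝒜 × χ → ℝ, Measurable l →
    MemLp l 2 (P.lawA.prod (P.μ.map X)) →
    MemLp (fun ω => l (P.A ω, X ω)) 2 P.μ →
    P.condAZ (fun ω => l (P.A ω, X ω)) =ᵐ[P.μ] 0 →
    l =ᵐ[P.lawA.prod (P.μ.map X)] 0

/-- `h` is a (square integrable) bridge function: `E[Y | A, Z] = E[h(A, W) | A, Z]`. -/
structure IsBridge (P : Population Ω 𝒰 𝒜 𝒵 𝒲) (h : 𝒜 → 𝒲 → ℝ) : Prop where
  measurable : Measurable (fun x : 𝒜 × 𝒲 => h x.1 x.2)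
  memLp : MemLp (fun ω => h (P.A ω) (P.W ω)) 2 P.μ
  bridge : P.condAZ P.Y =ᵐ[P.μ] P.condAZ (fun ω => h (P.A ω) (P.W ω))

/-- The support condition: `P_A ⊗ P_W` is absolutely continuous with respect to the joint law of
`(A, W)`, with Radon-Nikodym derivative at most `η`. -/
def GoodSupport (P : Population Ω 𝒰 𝒜 𝒵 𝒲) (η : ℝ) : Prop :=
  P.lawA.prod P.lawW ≤ ENNReal.ofReal η • P.lawAW

end Population

/-- The Kronecker product of two vectors. -/
def kron {p q : ℕ} (x : Fin p → ℝ) (y : Fin q → ℝ) : Fin p × Fin q → ℝ :=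
  fun ij => x ij.1 * y ij.2

/-- The squared Euclidean norm (for matrices, given by their entries: the Frobenius norm). -/
def sqNorm {ι : Type*} [Fintype ι] (x : ι → ℝ) : ℝ := ∑ i, x i ^ 2

/-- Stage 1 parameters `(V, θ_{A(1)}, θ_Z)`. -/
structure Param1 (ΘA1 ΘZ : Type*) (pA pZ d : ℕ) where
  V : Matrix (Fin d) (Fin pA × Fin pZ) ℝ
  θA : ΘA1
  θZ : ΘZ

/-- Stage 2 parameters `(u, θ_{A(2)}, θ_W)`. -/
structure Param2 (ΘA2 ΘW : Type*) (qA d : ℕ) where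
  u : Fin qA × Fin d → ℝ
  θA : ΘA2
  θW : ΘW

/-- The four parametrized feature maps and the sets of admissible parameters of the two stages. -/
structure Model (𝒜 𝒵 𝒲 ΘA1 ΘZ ΘA2 ΘW : Type*) [MeasurableSpace 𝒜] [MeasurableSpace 𝒵]
    [MeasurableSpace 𝒲] (pA pZ qA d : ℕ) where
  φA : ΘA1 → 𝒜 → (Fin pA → ℝ)
  φZ : ΘZ → 𝒵 → (Fin pZ → ℝ)
  ψA : ΘA2 → 𝒜 → (Fin qA → ℝ)
  ψW : ΘW → 𝒲 → (Fin d → ℝ)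
  meas_φA : ∀ θ, Measurable (φA θ)
  meas_φZ : ∀ θ, Measurable (φZ θ)
  meas_ψA : ∀ θ, Measurable (ψA θ)
  meas_ψW : ∀ θ, Measurable (ψW θ)
  adm1 : Set (Param1 ΘA1 ΘZ pA pZ d)
  adm2 : Set (Param2 ΘA2 ΘW qA d)

/-- The empirical Rademacher complexity of the class `H` on the sample `s`:
the average over all sign vectors `σ` of `sup_{h ∈ H} (1/k) ∑ i, σ i * h (s i)`. -/
noncomputable def empRademacher {S : Type*} {k : ℕ} (H : Set (S → ℝ)) (s : Fin k → S) : ℝ :=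
  ((2 : ℝ) ^ k)⁻¹ * ∑ σ : Fin k → Bool,
    ⨆ h : H, (k : ℝ)⁻¹ * ∑ i, (if σ i then (1 : ℝ) else -1) * h.1 (s i)

namespace Model

variable {𝒜 𝒵 𝒲 ΘA1 ΘZ ΘA2 ΘW : Type*} [MeasurableSpace 𝒜] [MeasurableSpace 𝒵]
    [MeasurableSpace 𝒲] {pA pZ qA d : ℕ}

/-- The stage 1 prediction `V (φ_A(a) ⊗ φ_Z(z))` of `E[ψ_W(W) | A = a, Z = z]`. -/
def pred1 (F : Model 𝒜 𝒵 𝒲 ΘA1 ΘZ ΘA2 ΘW pA pZ qA d) (q : Param1 ΘA1 ΘZ pA pZ d)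
    (a : 𝒜) (z : 𝒵) : Fin d → ℝ :=
  q.V.mulVec (kron (F.φA q.θA a) (F.φZ q.θZ z))

/-- The linear form `v ↦ uᵀ (ψ_A(a) ⊗ v)`. -/
def lin2 (F : Model 𝒜 𝒵 𝒲 ΘA1 ΘZ ΘA2 ΘW pA pZ qA d) (p : Param2 ΘA2 ΘW qA d)
    (a : 𝒜) (v : Fin d → ℝ) : ℝ :=
  p.u ⬝ᵥ kron (F.ψA p.θA a) v

/-- The model of the bridge function, `h(a, w) = uᵀ (ψ_A(a) ⊗ ψ_W(w))`. -/
def bridge (F : Model 𝒜 𝒵 𝒲 ΘA1 ΘZ ΘA2 ΘW pA pZ qA d) (p : Param2 ΘA2 ΘW qA d)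
    (a : 𝒜) (w : 𝒲) : ℝ :=
  F.lin2 p a (F.ψW p.θW w)

/-- The stage 1 loss at one observation. -/
def loss1 (F : Model 𝒜 𝒵 𝒲 ΘA1 ΘZ ΘA2 ΘW pA pZ qA d) (θ : ΘW) (q : Param1 ΘA1 ΘZ pA pZ d)
    (x : 𝒲 × 𝒜 × 𝒵) : ℝ :=
  sqNorm (F.ψW θ x.1 - F.pred1 q x.2.1 x.2.2)

/-- The stage 2 loss at one observation, when `q` is used as the stage 1 solution. -/
def loss2 (F : Model 𝒜 𝒵 𝒲 ΘA1 ΘZ ΘA2 ΘW pA pZ qA d) (p : Param2 ΘA2 ΘW qA d)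
    (q : Param1 ΘA1 ΘZ pA pZ d) (x : ℝ × 𝒜 × 𝒵) : ℝ :=
  (x.1 - F.lin2 p x.2.1 (F.pred1 q x.2.1 x.2.2)) ^ 2

/-- The stage 1 class `H₁`. -/
def class1 (F : Model 𝒜 𝒵 𝒲 ΘA1 ΘZ ΘA2 ΘW pA pZ qA d) : Set (𝒲 × 𝒜 × 𝒵 → ℝ) :=
  {f | ∃ p ∈ F.adm2, ∃ q ∈ F.adm1, f = F.loss1 p.θW q}

/-- The stage 2 class `H₂`. -/
def class2 (F : Model 𝒜 𝒵 𝒲 ΘA1 ΘZ ΘA2 ΘW pA pZ qA d) : Set (ℝ × 𝒜 × 𝒵 → ℝ) :=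
  {f | ∃ p ∈ F.adm2, ∃ q ∈ F.adm1, f = F.loss2 p q}

/-- The (ridge-penalized) empirical stage 1 loss, with target features `ψ_{θ_W}`. -/
noncomputable def empLoss1 (F : Model 𝒜 𝒵 𝒲 ΘA1 ΘZ ΘA2 ΘW pA pZ qA d) {m : ℕ} (lam : ℝ)
    (s : Fin m → 𝒲 × 𝒜 × 𝒵) (θ : ΘW) (q : Param1 ΘA1 ΘZ pA pZ d) : ℝ :=
  (m : ℝ)⁻¹ * ∑ i, F.loss1 θ q (s i) + lam * sqNorm (fun ij : Fin d × _ => q.V ij.1 ij.2)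

/-- The (ridge-penalized) empirical stage 2 loss, where `q θ_W` is the stage 1 solution for the
target features `ψ_{θ_W}`. -/
noncomputable def empLoss2 (F : Model 𝒜 𝒵 𝒲 ΘA1 ΘZ ΘA2 ΘW pA pZ qA d) {n : ℕ} (lam : ℝ)
    (s : Fin n → ℝ × 𝒜 × 𝒵) (q : ΘW → Param1 ΘA1 ΘZ pA pZ d) (p : Param2 ΘA2 ΘW qA d) : ℝ :=
  (n : ℝ)⁻¹ * ∑ i, F.loss2 p (q p.θW) (s i) + lam * sqNorm p.u

/-- `q θ_W` minimizes the empirical stage 1 loss for every admissible `θ_W`. -/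
def IsStage1Solution (F : Model 𝒜 𝒵 𝒲 ΘA1 ΘZ ΘA2 ΘW pA pZ qA d) {m : ℕ} (lam : ℝ)
    (s : Fin m → 𝒲 × 𝒜 × 𝒵) (q : ΘW → Param1 ΘA1 ΘZ pA pZ d) : Prop :=
  ∀ p ∈ F.adm2, q p.θW ∈ F.adm1 ∧
    ∀ q' ∈ F.adm1, F.empLoss1 lam s p.θW (q p.θW) ≤ F.empLoss1 lam s p.θW q'

/-- `p` minimizes the empirical stage 2 loss built from the stage 1 solution `q`. -/
def IsStage2Solution (F : Model 𝒜 𝒵 𝒲 ΘA1 ΘZ ΘA2 ΘW pA pZ qA d) {n : ℕ} (lam : ℝ)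
    (s : Fin n → ℝ × 𝒜 × 𝒵) (q : ΘW → Param1 ΘA1 ΘZ pA pZ d) (p : Param2 ΘA2 ΘW qA d) : Prop :=
  p ∈ F.adm2 ∧ ∀ p' ∈ F.adm2, F.empLoss2 lam s q p ≤ F.empLoss2 lam s q p'

/-- The estimated structural function `a ↦ uᵀ (ψ_A(a) ⊗ (1/k) ∑ i, ψ_W(w i))`. -/
noncomputable def fHat (F : Model 𝒜 𝒵 𝒲 ΘA1 ΘZ ΘA2 ΘW pA pZ qA d) (p : Param2 ΘA2 ΘW qA d)
    {k : ℕ} (w : Fin k → 𝒲) (a : 𝒜) : ℝ :=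
  F.lin2 p a ((k : ℝ)⁻¹ • ∑ i, F.ψW p.θW (w i))

/-- The classes of both stages are pointwise separable: some countable set of admissible
parameters gives functions that approximate, pointwise along a sequence, those of every admissible
parameter. This is automatic when the parameters range over subsets of Euclidean spaces and the
features are continuous in the parameters. -/
def PointwiseSeparable (F : Model 𝒜 𝒵 𝒲 ΘA1 ΘZ ΘA2 ΘW pA pZ qA d) : Prop :=
  (∃ D ⊆ F.adm1, D.Countable ∧ ∀ q ∈ F.adm1, ∃ r : ℕ → Param1 ΘA1 ΘZ pA pZ d,
    (∀ k, r k ∈ D) ∧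
      ∀ a z, Tendsto (fun k => F.pred1 (r k) a z) atTop (𝓝 (F.pred1 q a z))) ∧
  (∃ D ⊆ F.adm2, D.Countable ∧ ∀ p ∈ F.adm2, ∃ r : ℕ → Param2 ΘA2 ΘW qA d,
    (∀ k, r k ∈ D) ∧
      (∀ w, Tendsto (fun k => F.ψW (r k).θW w) atTop (𝓝 (F.ψW p.θW w))) ∧
      ∀ a v, Tendsto (fun k => F.lin2 (r k) a v) atTop (𝓝 (F.lin2 p a v)))

variable {Ω 𝒰 : Type*} [MeasurableSpace Ω] [MeasurableSpace 𝒰]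

/-- The boundedness conditions, with a common constant `M`: the outcome, the stage 1 predictions,
the stage 2 features and the linear forms of stage 2 (on the unit ball) are bounded by `M`. -/
structure BoundedBy (F : Model 𝒜 𝒵 𝒲 ΘA1 ΘZ ΘA2 ΘW pA pZ qA d)
    (P : Population Ω 𝒰 𝒜 𝒵 𝒲) (M : ℝ) : Prop where
  outcome : ∀ᵐ ω ∂P.μ, |P.Y ω| ≤ M
  stage1 : ∀ q ∈ F.adm1, ∀ a z, Real.sqrt (sqNorm (F.pred1 q a z)) ≤ M
  feature : ∀ p ∈ F.adm2, ∀ w, Real.sqrt (sqNorm (F.ψW p.θW w)) ≤ M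
  weight : ∀ p ∈ F.adm2, ∀ a v, sqNorm v ≤ 1 → |F.lin2 p a v| ≤ M

/-- The misspecification error of stage 1,
`κ₁ = sup_{θ_W} inf_{V, θ_{A(1)}, θ_Z} E ‖E[ψ_W(W) | A, Z] - V (φ_A(A) ⊗ φ_Z(Z))‖²`. -/
noncomputable def kappa1 (F : Model 𝒜 𝒵 𝒲 ΘA1 ΘZ ΘA2 ΘW pA pZ qA d)
    (P : Population Ω 𝒰 𝒜 𝒵 𝒲) : ℝ :=
  ⨆ p : F.adm2, ⨅ q : F.adm1,
    ∫ ω, sqNorm (fun i => P.condAZ (fun ω' => F.ψW p.1.θW (P.W ω') i) ω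
      - F.pred1 q.1 (P.A ω) (P.Z ω) i) ∂P.μ

/-- The misspecification error of stage 2,
`κ₂ = inf_{u, θ_{A(2)}, θ_W} ‖E[Y | A, Z] - E[h(A, W) | A, Z]‖` in `L²`. -/
noncomputable def kappa2 (F : Model 𝒜 𝒵 𝒲 ΘA1 ΘZ ΘA2 ΘW pA pZ qA d)
    (P : Population Ω 𝒰 𝒜 𝒵 𝒲) : ℝ :=
  ⨅ p : F.adm2,
    Real.sqrt (∫ ω, (P.condAZ P.Y ω
      - P.condAZ (fun ω' => F.bridge p.1 (P.A ω') (P.W ω')) ω) ^ 2 ∂P.μ)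

/-- The measure of ill-posedness of the bridge equation relative to the bridge model,
`τ = sup_h ‖h - h*‖_{L²(P_{A,W})} / ‖E[(h - h*)(A, W) | A, Z]‖_{L²}`, a value in `[0, ∞]`
(with `0 / 0 = 0` and `c / 0 = ∞` for `c > 0`). -/
noncomputable def illPosedness (F : Model 𝒜 𝒵 𝒲 ΘA1 ΘZ ΘA2 ΘW pA pZ qA d)
    (P : Population Ω 𝒰 𝒜 𝒵 𝒲) (hstar : 𝒜 → 𝒲 → ℝ) : ℝ≥0∞ :=
  ⨆ p ∈ F.adm2,
    eLpNorm (fun ω => F.bridge p (P.A ω) (P.W ω) - hstar (P.A ω) (P.W ω)) 2 P.μ /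
      eLpNorm (P.condAZ (fun ω => F.bridge p (P.A ω) (P.W ω) - hstar (P.A ω) (P.W ω))) 2 P.μ

end Model

end DFPV

/-! Identification comes first (`fStruct_ae_eq`). Put e(a,u) = E[Y | A=a, U=u] and g(a,u) =
E[h*(a,W) | U=u]. The two conditional independences and the tower property give e(A,U) and g(A,U)
the conditional expectations of Y and of h*(A,W) given (A,Z). These agree by the bridge equation, so
completeness for U yields e = g, and integrating over U gives f_struct(a) = E h*(a,W) for almost
every a.

The estimator replaces h* by the fitted bridge ĥ and the law of W by an empirical mean. Hence the
error is an average of h* - ĥ over W plus a Monte Carlo error for ĥ. The latter is of order 1/√n_W,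
because ĥ is fixed once the first two samples are. The former is at most √η ‖h* - ĥ‖ by Jensen and
the support condition, and τ turns this into the projected residual ‖E[Y - ĥ(A,W) | A,Z]‖.

The residual is controlled by two oracle inequalities (`excess1_stage1_le`,
`sqrt_integral_condAZ_sub_le`). By Pythagoras a population square loss is an irreducible term plus
an excess risk, so an empirical minimizer has excess risk at most misspecification, plus penalty,
plus two uniform deviations. Stage 1 is needed simultaneously for all θ_W, which is why κ₁ is a
supremum. As the bridge model is linear in the outcome features, with norm at most M, the stage 1
prediction can replace the true regression of the features at a cost of M times the root of the
stage 1 excess risk.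

Uniform deviations come from symmetrization and bounded differences
(`measure_uniform_deviation_le`). Since the constant may depend on δ in any way, a variance bound
with Chebyshev's inequality suffices and no exponential concentration is required. A union bound
over the exceptional events makes the dependence between the first two samples irrelevant. -/

namespace DFPV

/-! ### Variance of functions with bounded differences -/

section Concentration

variable {S : Type*} [MeasurableSpace S] {ν : Measure S} [IsProbabilityMeasure ν] {k : ℕ}

/-- A bounded measurable function is integrable for a finite measure. -/
lemma integrable_of_abs_le {X : Type*} [MeasurableSpace X] {μ : Measure X} [IsFiniteMeasure μ]
    {f : X → ℝ} (hf : Measurable f) {B : ℝ} (hB : ∀ x, |f x| ≤ B) : Integrable f μ :=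
  Integrable.of_bound hf.aestronglyMeasurable B (ae_of_all _ hB)

lemma memLp_of_abs_le {X : Type*} [MeasurableSpace X] {μ : Measure X} [IsFiniteMeasure μ]
    {f : X → ℝ} (hf : Measurable f) {B : ℝ} (hB : ∀ x, |f x| ≤ B) : MemLp f 2 μ :=
  MemLp.of_bound hf.aestronglyMeasurable B (ae_of_all _ hB)

lemma integral_comp_measurePreserving {X X' : Type*} [MeasurableSpace X] [MeasurableSpace X']
    {μ : Measure X} {μ' : Measure X'} {T : X → X'} (hT : MeasurePreserving T μ μ') {f : X' → ℝ}
    (hf : Measurable f) : ∫ x, f (T x) ∂μ = ∫ x, f x ∂μ' := by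
  rw [← hT.map_eq, integral_map hT.measurable.aemeasurable hf.aestronglyMeasurable]

lemma abs_integral_le_of_abs_le {X : Type*} [MeasurableSpace X] {μ : Measure X}
    [IsProbabilityMeasure μ] {f : X → ℝ} {B : ℝ} (hB : ∀ x, |f x| ≤ B) : |∫ x, f x ∂μ| ≤ B := by
  simpa using norm_integral_le_of_norm_le_const (μ := μ) (f := f) (ae_of_all _ hB)

/-- Bias-variance decomposition: the cross term vanishes because f minus its mean integrates to
zero. Applied on each fibre, it is the induction step of the variance bound below. -/
lemma integral_sub_const_sq {X : Type*} [MeasurableSpace X] {μ : Measure X}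
    [IsProbabilityMeasure μ] {f : X → ℝ} (hf : MemLp f 2 μ) (a : ℝ) :
    ∫ x, (f x - a) ^ 2 ∂μ = ∫ x, (f x - ∫ y, f y ∂μ) ^ 2 ∂μ + (∫ y, f y ∂μ - a) ^ 2 := by
  set m := ∫ y, f y ∂μ
  have h1 : Integrable f μ := hf.integrable one_le_two
  have h2 : Integrable (fun x => (f x - m) ^ 2) μ := (hf.sub (memLp_const m)).integrable_sq
  have h3 : ∀ x, (f x - a) ^ 2 = (f x - m) ^ 2 + (2 * (m - a) * (f x - m) + (m - a) ^ 2) := by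
    intro x; ring
  have h4 : Integrable (fun x => 2 * (m - a) * (f x - m)) μ :=
    (h1.sub (integrable_const m)).const_mul _
  simp_rw [h3]
  have h5 : Integrable (fun x => 2 * (m - a) * (f x - m) + (m - a) ^ 2) μ :=
    h4.add (integrable_const _)
  rw [integral_add h2 h5, integral_add h4 (integrable_const _), integral_const_mul,
    integral_sub h1 (integrable_const _)]
  simp [m]

/-- The variance of a function with bounded differences of independent variables. -/
theorem integral_sub_mean_sq_pi_le (c : ℝ) :
    ∀ (k : ℕ) (f : (Fin k → S) → ℝ), Measurable f → ∀ B : ℝ, (∀ x, |f x| ≤ B) →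
      (∀ x i y, |f (Function.update x i y) - f x| ≤ c) →
      ∫ x, (f x - ∫ y, f y ∂(Measure.pi fun _ => ν)) ^ 2 ∂(Measure.pi fun _ => ν) ≤ k * c ^ 2 := by
  intro k
  induction k with
  | zero =>
    intro f hf B hB hc
    have : ∀ x, f x = f default := fun x => by rw [Subsingleton.elim x default]
    simp [this]
  | succ k ih =>
    intro f hf B hB hc
    set ρ : Measure (Fin k → S) := Measure.pi fun _ => ν
    set e := MeasurableEquiv.piFinSuccAbove (fun _ : Fin (k + 1) => S) 0
    have he : MeasurePreserving e.symm (ν.prod ρ) (Measure.pi fun _ => ν) :=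
      (measurePreserving_piFinSuccAbove (fun _ : Fin (k + 1) => ν) 0).symm e
    have hint : ∀ g : (Fin (k + 1) → S) → ℝ,
        ∫ x, g x ∂(Measure.pi fun _ => ν) = ∫ x, g (e.symm x) ∂(ν.prod ρ) := fun g =>
      (he.integral_comp e.symm.measurableEmbedding g).symm
    rw [hint, hint]
    set F : S × (Fin k → S) → ℝ := fun x => f (e.symm x)
    have hF : Measurable F := hf.comp e.symm.measurable
    have hFB : ∀ x, |F x| ≤ B := fun x => hB _
    have hcons : ∀ a b, e.symm (a, b) = Fin.cons a b := by
      intro a b; simp [e, MeasurableEquiv.piFinSuccAbove]; rfl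
    -- Integrate out the first coordinate. On each fibre F stays within c of its average g, which
    -- contributes at most c² to the variance; the rest is the variance of g, a function of k
    -- coordinates that inherits the bounded differences.
    set g : (Fin k → S) → ℝ := fun y => ∫ x, F (x, y) ∂ν
    have hFx : ∀ y, Measurable fun x => F (x, y) := fun y => hF.comp (by fun_prop)
    have hFi : ∀ y, Integrable (fun x => F (x, y)) ν := fun y =>
      integrable_of_abs_le (hFx y) fun x => hFB _
    have hg : Measurable g :=
      (hF.stronglyMeasurable.integral_prod_left' (μ := ν)).measurable
    have hgB : ∀ y, |g y| ≤ B := fun y =>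
      abs_integral_le_of_abs_le fun x => hFB (x, y)
    have hgc : ∀ x i y, |g (Function.update x i y) - g x| ≤ c := by
      intro x i y
      simp only [g]
      rw [← integral_sub (hFi _) (hFi _)]
      refine abs_integral_le_of_abs_le fun t => ?_
      have h := hc (Fin.cons t x) i.succ y
      rw [← Fin.cons_update] at h
      simpa [F, hcons] using h
    have hFc : ∀ x x' y, |F (x, y) - F (x', y)| ≤ c := by
      intro x x' y
      have h := hc (Fin.cons x' y) 0 x
      rw [Fin.update_cons_zero] at h
      simpa [F, hcons] using h
    have hFg : ∀ x y, (F (x, y) - g y) ^ 2 ≤ c ^ 2 := by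
      intro x y
      have h : |F (x, y) - g y| ≤ c := by
        have h0 : F (x, y) - g y = ∫ x', (F (x, y) - F (x', y)) ∂ν := by
          rw [integral_sub (integrable_const _) (hFi _)]; simp [g]
        rw [h0]
        exact abs_integral_le_of_abs_le fun t => hFc _ _ _
      have := abs_nonneg (F (x, y) - g y)
      rw [← sq_abs]; gcongr
    have hmean : ∫ x, F x ∂(ν.prod ρ) = ∫ y, g y ∂ρ :=
      integral_prod_symm _ (integrable_of_abs_le hF hFB)
    rw [hmean]
    set a := ∫ y, g y ∂ρ
    have hsqint : Integrable (fun x => (F x - a) ^ 2) (ν.prod ρ) :=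
      ((memLp_of_abs_le hF hFB).sub (memLp_const a)).integrable_sq
    have hgint : Integrable (fun y => (g y - a) ^ 2) ρ :=
      ((memLp_of_abs_le hg hgB).sub (memLp_const a)).integrable_sq
    rw [integral_prod_symm _ hsqint]
    calc ∫ y, ∫ x, (F (x, y) - a) ^ 2 ∂ν ∂ρ
        ≤ ∫ y, (c ^ 2 + (g y - a) ^ 2) ∂ρ := by
          refine integral_mono hsqint.integral_prod_right ((integrable_const _).add hgint) ?_
          intro y
          dsimp only
          rw [integral_sub_const_sq (memLp_of_abs_le (hFx y) fun x => hFB _) a]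
          have : ∫ x, (F (x, y) - g y) ^ 2 ∂ν ≤ ∫ _, c ^ 2 ∂ν :=
            integral_mono_of_nonneg (ae_of_all _ fun x => sq_nonneg _) (integrable_const _)
              (ae_of_all _ fun x => hFg x y)
          simp only [integral_const, probReal_univ, one_smul] at this
          simp only [g] at *
          linarith
      _ = c ^ 2 + ∫ y, (g y - a) ^ 2 ∂ρ := by
          rw [integral_add (integrable_const _) hgint]; simp
      _ ≤ (k + 1 : ℕ) * c ^ 2 := by
          have := ih g hg B hgB hgc
          push_cast
          linarith

/-- Chebyshev's inequality for a function with bounded differences. -/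
theorem measure_pi_deviation_le {f : (Fin k → S) → ℝ} (hf : Measurable f) {B c t : ℝ}
    (hB : ∀ x, |f x| ≤ B) (hc : ∀ x i y, |f (Function.update x i y) - f x| ≤ c) (ht : 0 < t) :
    (Measure.pi fun _ => ν) {x | t ≤ |f x - ∫ y, f y ∂(Measure.pi fun _ => ν)|}
      ≤ ENNReal.ofReal (k * c ^ 2 / t ^ 2) := by
  refine (meas_ge_le_variance_div_sq (memLp_of_abs_le hf hB) ht).trans ?_
  gcongr
  rw [variance_eq_integral hf.aemeasurable]
  exact integral_sub_mean_sq_pi_le c k f hf B hB hc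

end Concentration

/-! ### Rademacher complexity and symmetrization -/

section Rademacher

variable {S : Type*} {k : ℕ}

/-- The supremum, over a class of functions, of the empirical means with signs `σ`. -/
noncomputable def signedSup (D : Set (S → ℝ)) (σ : Fin k → Bool) (s : Fin k → S) : ℝ :=
  ⨆ h : D, (k : ℝ)⁻¹ * ∑ i, (if σ i then (1 : ℝ) else -1) * h.1 (s i)

/-- The largest excess of the expectation over the empirical mean, over a class of functions. -/
noncomputable def devSup [MeasurableSpace S] (ν : Measure S) (D : Set (S → ℝ)) (s : Fin k → S) :
    ℝ :=
  ⨆ h : D, (∫ x, h.1 x ∂ν - (k : ℝ)⁻¹ * ∑ i, h.1 (s i))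

lemma empRademacher_eq_sum_signedSup (D : Set (S → ℝ)) (s : Fin k → S) :
    empRademacher D s = ((2 : ℝ) ^ k)⁻¹ * ∑ σ : Fin k → Bool, signedSup D σ s := rfl

lemma abs_inv_mul_sum_le {B : ℝ} (hB : 0 ≤ B) {a : Fin k → ℝ} (ha : ∀ i, |a i| ≤ B) :
    |(k : ℝ)⁻¹ * ∑ i, a i| ≤ B := by
  rcases Nat.eq_zero_or_pos k with rfl | hk
  · simpa using hB
  have hk' : (0 : ℝ) < k := by exact_mod_cast hk
  rw [abs_mul, abs_of_pos (inv_pos.2 hk'), inv_mul_le_iff₀ hk']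
  calc |∑ i, a i| ≤ ∑ i, |a i| := Finset.abs_sum_le_sum_abs _ _
    _ ≤ ∑ _i : Fin k, B := Finset.sum_le_sum fun i _ => ha i
    _ = k * B := by simp

lemma abs_sign (b : Bool) : |(if b then (1 : ℝ) else -1)| = 1 := by cases b <;> simp

lemma abs_sign_mul (b : Bool) (x : ℝ) : |(if b then (1 : ℝ) else -1) * x| = |x| := by
  rw [abs_mul, abs_sign, one_mul]

lemma abs_ciSup_le {ι : Type*} [Nonempty ι] {f : ι → ℝ} {B : ℝ} (hf : ∀ i, |f i| ≤ B) :
    |⨆ i, f i| ≤ B := by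
  have hb : BddAbove (Set.range f) := ⟨B, by rintro _ ⟨i, rfl⟩; exact (abs_le.1 (hf i)).2⟩
  rw [abs_le]
  obtain ⟨i⟩ := ‹Nonempty ι›
  exact ⟨(abs_le.1 (hf i)).1.trans (le_ciSup hb i), ciSup_le fun i => (abs_le.1 (hf i)).2⟩

lemma abs_ciSup_sub_ciSup_le {ι : Type*} [Nonempty ι] {f g : ι → ℝ} {c : ℝ}
    (hf : BddAbove (Set.range f)) (hg : BddAbove (Set.range g)) (h : ∀ i, |f i - g i| ≤ c) :
    |(⨆ i, f i) - ⨆ i, g i| ≤ c := by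
  rw [abs_le]
  constructor
  · have : (⨆ i, g i) ≤ (⨆ i, f i) + c := ciSup_le fun i => by
      have := (abs_le.1 (h i)).1
      have := le_ciSup hf i
      linarith
    linarith
  · have : (⨆ i, f i) ≤ (⨆ i, g i) + c := ciSup_le fun i => by
      have := (abs_le.1 (h i)).2
      have := le_ciSup hg i
      linarith
    linarith

/-- Only the j-th term changes, by at most 2B before division by k. The constant sign vector `true`
gives the version for plain empirical means. -/
lemma abs_inv_mul_sum_update_sub_le {B : ℝ} (σ : Fin k → Bool) {h : S → ℝ}
    (hB : ∀ x, |h x| ≤ B) (s : Fin k → S) (j : Fin k) (y : S) :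
    |(k : ℝ)⁻¹ * ∑ i, (if σ i then (1 : ℝ) else -1) * h (Function.update s j y i)
      - (k : ℝ)⁻¹ * ∑ i, (if σ i then (1 : ℝ) else -1) * h (s i)| ≤ 2 * B / k := by
  have hk' : (0 : ℝ) < k := by exact_mod_cast j.pos
  rw [← mul_sub, ← Finset.sum_sub_distrib, abs_mul, abs_of_pos (inv_pos.2 hk'),
    inv_mul_le_iff₀ hk', mul_div_cancel₀ _ hk'.ne', Finset.sum_eq_single j]
  · rw [← mul_sub, abs_sign_mul, Function.update_self]
    have h1 := abs_le.1 (hB y)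
    have h2 := abs_le.1 (hB (s j))
    rw [abs_le]; constructor <;> linarith
  · intro i _ hi
    simp [Function.update_of_ne hi]
  · simp

section Bounded

variable {D : Set (S → ℝ)} {B : ℝ}

/-- A real supremum over an unbounded family is 0 by convention, so `le_ciSup` needs this. The bound
is only required on a set T containing the sample, since the stage 2 losses are bounded only where
the outcome is. -/
lemma bddAbove_signed (hB0 : 0 ≤ B) {T : Set S} (hB : ∀ h ∈ D, ∀ x ∈ T, |h x| ≤ B)
    (σ : Fin k → Bool) {s : Fin k → S} (hs : ∀ i, s i ∈ T) :
    BddAbove (Set.range fun h : D =>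
      (k : ℝ)⁻¹ * ∑ i, (if σ i then (1 : ℝ) else -1) * h.1 (s i)) := by
  refine ⟨B, ?_⟩
  rintro _ ⟨h, rfl⟩
  refine (le_abs_self _).trans (abs_inv_mul_sum_le hB0 fun i => ?_)
  rw [abs_sign_mul]
  exact hB _ h.2 _ (hs i)

lemma bound_nonneg [hS : Nonempty S] (hB : ∀ h ∈ D, ∀ x, |h x| ≤ B) (hD : D.Nonempty)
    : 0 ≤ B := by
  obtain ⟨h, hh⟩ := hD
  obtain ⟨x⟩ := hS
  exact (abs_nonneg _).trans (hB h hh x)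

lemma abs_signedSup_le [Nonempty S] (hB : ∀ h ∈ D, ∀ x, |h x| ≤ B) (hD : D.Nonempty)
    (σ : Fin k → Bool) (s : Fin k → S) :
    |signedSup D σ s| ≤ B := by
  have : Nonempty D := hD.to_subtype
  refine abs_ciSup_le fun h => abs_inv_mul_sum_le (bound_nonneg hB hD) fun i => ?_
  rw [abs_sign_mul]
  exact hB _ h.2 _

lemma abs_signedSup_update_sub_le (hB : ∀ h ∈ D, ∀ x, |h x| ≤ B) (hD : D.Nonempty)
    (σ : Fin k → Bool) (s : Fin k → S) (j : Fin k) (y : S) :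
    |signedSup D σ (Function.update s j y) - signedSup D σ s| ≤ 2 * B / k := by
  have : Nonempty D := hD.to_subtype
  have : Nonempty S := ⟨y⟩
  have hB' : ∀ h ∈ D, ∀ x ∈ Set.univ, |h x| ≤ B := fun h hh x _ => hB h hh x
  exact abs_ciSup_sub_ciSup_le
    (bddAbove_signed (bound_nonneg hB hD) hB' σ fun _ => Set.mem_univ _)
    (bddAbove_signed (bound_nonneg hB hD) hB' σ fun _ => Set.mem_univ _)
    fun h => abs_inv_mul_sum_update_sub_le σ (hB _ h.2) s j y

lemma abs_avg_sign_le {a : (Fin k → Bool) → ℝ} {c : ℝ} (ha : ∀ σ, |a σ| ≤ c) :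
    |((2 : ℝ) ^ k)⁻¹ * ∑ σ : Fin k → Bool, a σ| ≤ c := by
  rw [abs_mul, abs_of_pos (by positivity), inv_mul_le_iff₀ (by positivity)]
  calc |∑ σ, a σ| ≤ ∑ σ, |a σ| := Finset.abs_sum_le_sum_abs _ _
    _ ≤ ∑ _σ : Fin k → Bool, c := Finset.sum_le_sum fun σ _ => ha σ
    _ = 2 ^ k * c := by simp

lemma abs_empRademacher_le [Nonempty S] (hB : ∀ h ∈ D, ∀ x, |h x| ≤ B) (hD : D.Nonempty)
    (s : Fin k → S) : |empRademacher D s| ≤ B :=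
  abs_avg_sign_le fun σ => abs_signedSup_le hB hD σ s

lemma abs_empRademacher_update_sub_le (hB : ∀ h ∈ D, ∀ x, |h x| ≤ B) (hD : D.Nonempty)
    (s : Fin k → S) (j : Fin k) (y : S) :
    |empRademacher D (Function.update s j y) - empRademacher D s| ≤ 2 * B / k := by
  rw [empRademacher_eq_sum_signedSup, empRademacher_eq_sum_signedSup, ← mul_sub,
    ← Finset.sum_sub_distrib]
  exact abs_avg_sign_le fun σ => abs_signedSup_update_sub_le hB hD σ s j y

variable [MeasurableSpace S] {ν : Measure S} [IsProbabilityMeasure ν]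

lemma abs_dev_le (hB : ∀ h ∈ D, ∀ x, |h x| ≤ B) (hD : D.Nonempty)
    (h : D) (s : Fin k → S) :
    |∫ x, h.1 x ∂ν - (k : ℝ)⁻¹ * ∑ i, h.1 (s i)| ≤ 2 * B := by
  have : Nonempty S := nonempty_of_isProbabilityMeasure ν
  have h1 := abs_integral_le_of_abs_le (μ := ν) (hB _ h.2)
  have h2 := abs_inv_mul_sum_le (bound_nonneg hB hD) (a := fun i => h.1 (s i))
    fun i => hB _ h.2 (s i)
  have := abs_le.1 h1
  have := abs_le.1 h2
  rw [abs_le]; constructor <;> linarith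

lemma bddAbove_dev (hB : ∀ h ∈ D, ∀ x, |h x| ≤ B) (hD : D.Nonempty)
    (s : Fin k → S) :
    BddAbove (Set.range fun h : D => ∫ x, h.1 x ∂ν - (k : ℝ)⁻¹ * ∑ i, h.1 (s i)) := by
  refine ⟨2 * B, ?_⟩
  rintro _ ⟨h, rfl⟩
  exact (abs_le.1 (abs_dev_le hB hD h s)).2

lemma abs_devSup_le (hB : ∀ h ∈ D, ∀ x, |h x| ≤ B) (hD : D.Nonempty)
    (s : Fin k → S) : |devSup ν D s| ≤ 2 * B := by
  have : Nonempty D := hD.to_subtype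
  exact abs_ciSup_le fun h => abs_dev_le hB hD h s

lemma abs_devSup_update_sub_le (hB : ∀ h ∈ D, ∀ x, |h x| ≤ B) (hD : D.Nonempty)
    (s : Fin k → S) (j : Fin k) (y : S) :
    |devSup ν D (Function.update s j y) - devSup ν D s| ≤ 2 * B / k := by
  have : Nonempty D := hD.to_subtype
  refine abs_ciSup_sub_ciSup_le (bddAbove_dev hB hD _) (bddAbove_dev hB hD _) fun h => ?_
  have := abs_inv_mul_sum_update_sub_le (fun _ => true) (hB _ h.2) s j y
  simp only [if_true, one_mul] at this
  rw [abs_sub_comm] at this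
  convert this using 2
  ring

end Bounded

section Measurability

variable [MeasurableSpace S] {D : Set (S → ℝ)}

/-- Countability of the class is what makes its supremum measurable; this is the reason for passing
to a countable subclass later. -/
lemma measurable_signedSup (hc : D.Countable) (hm : ∀ h ∈ D, Measurable h)
    (σ : Fin k → Bool) : Measurable (signedSup D σ) := by
  have : Countable D := hc.to_subtype
  refine Measurable.iSup fun h => ?_
  have := hm _ h.2
  fun_prop

lemma measurable_empRademacher (hc : D.Countable) (hm : ∀ h ∈ D, Measurable h) :
    Measurable (empRademacher (k := k) D) := by
  refine Measurable.const_mul (Finset.measurable_sum _ fun σ _ => ?_) _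
  exact measurable_signedSup hc hm σ

lemma measurable_devSup (hc : D.Countable) (hm : ∀ h ∈ D, Measurable h)
    (ν : Measure S) : Measurable (devSup (k := k) ν D) := by
  have : Countable D := hc.to_subtype
  refine Measurable.iSup fun h => ?_
  have := hm _ h.2
  fun_prop

end Measurability

section Symmetrization

variable [MeasurableSpace S] {ν : Measure S} [IsProbabilityMeasure ν]

/-- Symmetrization: coordinates of a sample and of its independent copy may be exchanged. -/
lemma measurePreserving_swap_coordinates (σ : Fin k → Bool) :
    MeasurePreserving (fun (p : Fin k → S × S) i => if σ i then p i else (p i).swap)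
      (Measure.pi fun _ => ν.prod ν) (Measure.pi fun _ => ν.prod ν) := by
  refine measurePreserving_pi _ _ (f := fun i (x : S × S) => if σ i then x else x.swap) fun i => ?_
  cases σ i
  · simpa using Measure.measurePreserving_swap
  · simpa [Function.id_def] using MeasurePreserving.id (ν.prod ν)

/-- The expected maximal deviation is at most twice the expected Rademacher complexity. -/
theorem integral_devSup_le (hk : 0 < k) {D : Set (S → ℝ)} {B : ℝ} (hD : D.Nonempty)
    (hc : D.Countable) (hm : ∀ h ∈ D, Measurable h) (hB : ∀ h ∈ D, ∀ x, |h x| ≤ B) :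
    ∫ s, devSup ν D s ∂(Measure.pi fun _ : Fin k => ν)
      ≤ 2 * ∫ s, empRademacher D s ∂(Measure.pi fun _ : Fin k => ν) := by
  have : Nonempty S := nonempty_of_isProbabilityMeasure ν
  have : Nonempty D := hD.to_subtype
  have : Countable D := hc.to_subtype
  have hB0 : 0 ≤ B := bound_nonneg hB hD
  have hk' : (k : ℝ) ≠ 0 := by exact_mod_cast hk.ne'
  set ρ : Measure (Fin k → S) := Measure.pi fun _ => ν
  -- The symmetrized supremum over a sample `x.1` and its ghost copy `x.2`. With all signs `true`
  -- its ghost average dominates `devSup`; with general signs it splits into two Rademacher suprema.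
  let Φ : (Fin k → Bool) → (Fin k → S) × (Fin k → S) → ℝ := fun σ x =>
    ⨆ h : D, (k : ℝ)⁻¹ * ∑ i, (if σ i then (1 : ℝ) else -1) * (h.1 (x.2 i) - h.1 (x.1 i))
  have hΦ1 : ∀ (σ : Fin k → Bool) (x : (Fin k → S) × (Fin k → S)) (h : D),
      |(k : ℝ)⁻¹ * ∑ i, (if σ i then (1 : ℝ) else -1) * (h.1 (x.2 i) - h.1 (x.1 i))|
        ≤ 2 * B := by
    intro σ x h
    refine abs_inv_mul_sum_le (by positivity) fun i => ?_
    rw [abs_sign_mul]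
    have h1 := abs_le.1 (hB _ h.2 (x.2 i))
    have h2 := abs_le.1 (hB _ h.2 (x.1 i))
    rw [abs_le]; constructor <;> linarith
  have hΦbdd : ∀ (σ : Fin k → Bool) (x : (Fin k → S) × (Fin k → S)), BddAbove (Set.range fun h : D =>
      (k : ℝ)⁻¹ * ∑ i, (if σ i then (1 : ℝ) else -1) * (h.1 (x.2 i) - h.1 (x.1 i))) := by
    intro σ x
    refine ⟨2 * B, ?_⟩
    rintro _ ⟨h, rfl⟩
    exact (abs_le.1 (hΦ1 σ x h)).2
  have hΦm : ∀ σ, Measurable (Φ σ) := by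
    intro σ
    refine Measurable.iSup fun h => ?_
    have := hm _ h.2
    fun_prop
  have hΦB : ∀ σ x, |Φ σ x| ≤ 2 * B := fun σ x => abs_ciSup_le (hΦ1 σ x)
  have hΦi : ∀ σ, Integrable (Φ σ) (ρ.prod ρ) := fun σ => integrable_of_abs_le (hΦm σ) (hΦB σ)
  have hsi : ∀ σ, Integrable (signedSup D σ) ρ := fun σ =>
    integrable_of_abs_le (measurable_signedSup hc hm σ) (abs_signedSup_le hB hD σ)
  -- exchanging coordinates
  have hswap : ∀ σ, ∫ x, Φ (fun _ => true) x ∂(ρ.prod ρ) = ∫ x, Φ σ x ∂(ρ.prod ρ) := by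
    intro σ
    have he := measurePreserving_arrowProdEquivProdArrow S S (Fin k) (fun _ => ν) (fun _ => ν)
    have hT := measurePreserving_swap_coordinates (ν := ν) σ
    rw [← he.integral_comp (MeasurableEquiv.measurableEmbedding _),
      ← he.integral_comp (MeasurableEquiv.measurableEmbedding _)]
    refine (integral_comp_measurePreserving hT
      ((hΦm fun _ => true).comp he.measurable)).symm.trans ?_
    refine integral_congr_ae (ae_of_all _ fun p => iSup_congr fun h => ?_)
    congr 1
    refine Finset.sum_congr rfl fun i _ => ?_
    simp only [MeasurableEquiv.arrowProdEquivProdArrow, MeasurableEquiv.coe_mk,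
      Equiv.arrowProdEquivProdArrow_apply, if_true, one_mul]
    -- Where the sign is `false`, the swap exchanges sample and ghost point, and their difference
    -- changes sign.
    cases σ i <;> simp
  -- the ghost sample
  have hghost : ∫ s, devSup ν D s ∂ρ ≤ ∫ x, Φ (fun _ => true) x ∂(ρ.prod ρ) := by
    rw [integral_prod _ (hΦi _)]
    refine integral_mono (integrable_of_abs_le (measurable_devSup hc hm ν)
      (abs_devSup_le hB hD)) (hΦi _).integral_prod_left fun x => ?_
    refine ciSup_le fun h => ?_
    have hi : ∀ i, Integrable (fun y : Fin k → S => h.1 (y i)) ρ := fun i =>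
      integrable_of_abs_le ((hm _ h.2).comp (measurable_pi_apply i)) fun y => hB _ h.2 _
    have hval : ∀ i, ∫ y : Fin k → S, h.1 (y i) ∂ρ = ∫ x, h.1 x ∂ν := by
      exact fun i => integral_comp_measurePreserving (measurePreserving_eval (fun _ => ν) i)
        (hm _ h.2)
    have heq : ∫ x, h.1 x ∂ν - (k : ℝ)⁻¹ * ∑ i, h.1 (x i)
        = ∫ y, (k : ℝ)⁻¹ * ∑ i, (h.1 (y i) - h.1 (x i)) ∂ρ := by
      have hs : ∀ i ∈ Finset.univ,
          Integrable (fun y : Fin k → S => h.1 (y i) - h.1 (x i)) ρ :=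
        fun i _ => (hi i).sub (integrable_const _)
      rw [integral_const_mul, integral_finsetSum _ hs]
      simp_rw [integral_sub (hi _) (integrable_const _), hval]
      simp only [integral_const, probReal_univ, one_smul, Finset.sum_sub_distrib,
        Finset.sum_const, Finset.card_univ, Fintype.card_fin, nsmul_eq_mul]
      field_simp
    rw [heq]
    refine integral_mono ((integrable_finsetSum _ fun i _ =>
      (hi i).sub (integrable_const _)).const_mul _)
      (integrable_of_abs_le ((hΦm _).comp measurable_prodMk_left) fun y => hΦB _ _) fun y => ?_
    have := le_ciSup (hΦbdd (fun _ => true) (x, y)) h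
    simpa [Φ] using this
  -- splitting the symmetrized supremum
  have hsplit : ∀ σ, ∫ x, Φ σ x ∂(ρ.prod ρ)
      ≤ ∫ s, signedSup D σ s ∂ρ + ∫ s, signedSup D (fun i => !σ i) s ∂ρ := by
    intro σ
    have h1 : Integrable (fun x : (Fin k → S) × (Fin k → S) => signedSup D σ x.2) (ρ.prod ρ) :=
      (hsi σ).comp_snd ρ
    have h2 : Integrable (fun x : (Fin k → S) × (Fin k → S) =>
        signedSup D (fun i => !σ i) x.1) (ρ.prod ρ) := (hsi _).comp_fst ρ
    have e1 : ∫ s, signedSup D σ s ∂ρ = ∫ x, signedSup D σ x.2 ∂(ρ.prod ρ) := by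
      rw [integral_fun_snd]; simp
    have e2 : ∫ s, signedSup D (fun i => !σ i) s ∂ρ
        = ∫ x, signedSup D (fun i => !σ i) x.1 ∂(ρ.prod ρ) := by
      rw [integral_fun_fst]; simp
    rw [e1, e2, ← integral_add h1 h2]
    refine integral_mono (hΦi σ) (h1.add h2) fun x => ciSup_le fun h => ?_
    have hB' : ∀ h ∈ D, ∀ x ∈ Set.univ, |h x| ≤ B := fun h hh x _ => hB h hh x
    have l1 := le_ciSup (bddAbove_signed hB0 hB' σ (s := x.2) fun _ => Set.mem_univ _) h
    have l2 := le_ciSup (bddAbove_signed hB0 hB' (fun i => !σ i) (s := x.1)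
      fun _ => Set.mem_univ _) h
    refine le_trans (le_of_eq ?_) (add_le_add l1 l2)
    rw [← mul_add, ← Finset.sum_add_distrib]
    congr 1
    refine Finset.sum_congr rfl fun i _ => ?_
    cases σ i <;> simp <;> ring
  -- Flipping all signs permutes the sign vectors, so both halves of the split have the same total.
  -- This is the origin of the factor 2.
  have hneg : ∑ σ : Fin k → Bool, ∫ s, signedSup D (fun i => !σ i) s ∂ρ
      = ∑ σ : Fin k → Bool, ∫ s, signedSup D σ s ∂ρ :=
    Equiv.sum_comp (Function.Involutive.toPerm (fun (σ : Fin k → Bool) i => !σ i)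
      fun σ => by ext; simp) fun σ => ∫ s, signedSup D σ s ∂ρ
  have hR : ∫ s, empRademacher D s ∂ρ
      = ((2 : ℝ) ^ k)⁻¹ * ∑ σ : Fin k → Bool, ∫ s, signedSup D σ s ∂ρ := by
    simp_rw [empRademacher_eq_sum_signedSup]
    rw [integral_const_mul, integral_finsetSum _ fun σ _ => hsi σ]
  have hsum : (2 : ℝ) ^ k * ∫ x, Φ (fun _ => true) x ∂(ρ.prod ρ)
      ≤ 2 * ∑ σ : Fin k → Bool, ∫ s, signedSup D σ s ∂ρ := by
    calc (2 : ℝ) ^ k * ∫ x, Φ (fun _ => true) x ∂(ρ.prod ρ)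
        = ∑ _σ : Fin k → Bool, ∫ x, Φ (fun _ => true) x ∂(ρ.prod ρ) := by simp
      _ ≤ ∑ σ : Fin k → Bool,
          (∫ s, signedSup D σ s ∂ρ + ∫ s, signedSup D (fun i => !σ i) s ∂ρ) :=
          Finset.sum_le_sum fun σ _ => (hswap σ).trans_le (hsplit σ)
      _ = _ := by rw [Finset.sum_add_distrib, hneg]; ring
  refine hghost.trans ?_
  rw [hR]
  have h2 : (0 : ℝ) < 2 ^ k := by positivity
  rw [← mul_le_mul_iff_right₀ h2]
  refine hsum.trans (le_of_eq ?_)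
  field_simp

end Symmetrization

/-- Pair σ with its opposite: each supremum is at least the value at h₀, and the two values at h₀
cancel. Nonnegativity lets constants be absorbed into the complexities in the final bound. -/
lemma empRademacher_nonneg {H : Set (S → ℝ)} {h₀ : S → ℝ} (hh₀ : h₀ ∈ H) {T : Set S} {B : ℝ}
    (hB0 : 0 ≤ B) (hB : ∀ h ∈ H, ∀ x ∈ T, |h x| ≤ B) {s : Fin k → S} (hs : ∀ i, s i ∈ T) :
    0 ≤ empRademacher H s := by
  have hneg : ∑ σ : Fin k → Bool, signedSup H (fun i => !σ i) s = ∑ σ, signedSup H σ s :=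
    Equiv.sum_comp (Function.Involutive.toPerm (fun (σ : Fin k → Bool) i => !σ i)
      fun σ => by ext; simp) fun σ => signedSup H σ s
  have hpos : 0 ≤ ∑ σ : Fin k → Bool, (signedSup H σ s + signedSup H (fun i => !σ i) s) := by
    refine Finset.sum_nonneg fun σ _ => ?_
    have l₁ := le_ciSup (bddAbove_signed hB0 hB σ hs) ⟨h₀, hh₀⟩
    have l₂ := le_ciSup (bddAbove_signed hB0 hB (fun i => !σ i) hs) ⟨h₀, hh₀⟩
    refine le_trans (le_of_eq ?_) (add_le_add l₁ l₂)
    rw [← mul_add, ← Finset.sum_add_distrib, Finset.sum_eq_zero, mul_zero]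
    intro i _
    cases σ i <;> simp
  rw [Finset.sum_add_distrib, hneg] at hpos
  rw [empRademacher_eq_sum_signedSup]
  exact mul_nonneg (by positivity) (by linarith)

lemma signedSup_neg_image (D : Set (S → ℝ)) (σ : Fin k → Bool) (s : Fin k → S) :
    signedSup ((fun g => -g) '' D) σ s = signedSup D (fun i => !σ i) s := by
  have h := ((Equiv.neg (S → ℝ)).image D).iSup_comp
    (g := fun h : ((Equiv.neg (S → ℝ)) '' D : Set (S → ℝ)) =>
      (k : ℝ)⁻¹ * ∑ i, (if σ i then (1 : ℝ) else -1) * h.1 (s i))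
  refine Eq.trans h.symm (iSup_congr fun h => ?_)
  congr 1
  refine Finset.sum_congr rfl fun i _ => ?_
  cases hσ : σ i <;> simp [hσ]

/-- Negating the class flips all signs, which only permutes the average. Two-sided deviations
therefore follow from one-sided ones for a class and its negative, at the same complexity. -/
lemma empRademacher_neg_image (D : Set (S → ℝ)) (s : Fin k → S) :
    empRademacher ((fun g => -g) '' D) s = empRademacher D s := by
  simp_rw [empRademacher_eq_sum_signedSup, signedSup_neg_image]
  congr 1
  exact Equiv.sum_comp (Function.Involutive.toPerm (fun (σ : Fin k → Bool) i => !σ i)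
      fun σ => by ext; simp) fun σ => signedSup D σ s

end Rademacher

/-! ### Uniform deviations in terms of the empirical Rademacher complexity -/

section UniformDeviation

variable {S : Type*} [MeasurableSpace S] {ν : Measure S} [IsProbabilityMeasure ν] {k : ℕ}

/-- With high probability the maximal deviation is at most twice the empirical Rademacher
complexity, up to a term of order `1 / √k`. -/
theorem measure_devSup_gt_le (hk : 0 < k) {D : Set (S → ℝ)} {B : ℝ} (hD : D.Nonempty)
    (hc : D.Countable) (hm : ∀ h ∈ D, Measurable h) (hB : ∀ h ∈ D, ∀ x, |h x| ≤ B) {t : ℝ}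
    (ht : 0 < t) :
    (Measure.pi fun _ : Fin k => ν) {s | 2 * empRademacher D s + 3 * t / √k < devSup ν D s}
      ≤ ENNReal.ofReal (8 * B ^ 2 / t ^ 2) := by
  have : Nonempty S := nonempty_of_isProbabilityMeasure ν
  have hk' : (0 : ℝ) < k := by exact_mod_cast hk
  have hsq : 0 < √(k : ℝ) := Real.sqrt_pos.2 hk'
  have htk : 0 < t / √k := div_pos ht hsq
  set ρ : Measure (Fin k → S) := Measure.pi fun _ => ν
  have h1 := measure_pi_deviation_le (ν := ν) (measurable_devSup (k := k) hc hm ν)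
    (abs_devSup_le hB hD) (abs_devSup_update_sub_le hB hD) htk
  have h2 := measure_pi_deviation_le (ν := ν) (measurable_empRademacher (k := k) hc hm)
    (abs_empRademacher_le hB hD) (abs_empRademacher_update_sub_le hB hD) htk
  -- Bounded differences of size 2B/k give a variance of at most 4B²/k, so deviations at scale t/√k
  -- have probability at most 4B²/t².
  have hval : (k : ℝ) * (2 * B / k) ^ 2 / (t / √k) ^ 2 = 4 * B ^ 2 / t ^ 2 := by
    rw [div_pow t, Real.sq_sqrt hk'.le]
    field_simp
    ring
  rw [hval] at h1 h2
  have h3 := integral_devSup_le (ν := ν) hk hD hc hm hB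
  have hsum : (8 * B ^ 2 / t ^ 2 : ℝ) = 4 * B ^ 2 / t ^ 2 + 4 * B ^ 2 / t ^ 2 := by ring
  rw [hsum, ENNReal.ofReal_add (by positivity) (by positivity)]
  refine (measure_mono fun s hs => ?_).trans ((measure_union_le _ _).trans (add_le_add h1 h2))
  by_contra hns
  simp only [Set.mem_union, Set.mem_ofPred_eq, not_or, not_le] at hns hs
  -- The factor 3 in the threshold: one t/√k for the maximal deviation, and two for replacing twice
  -- the expected complexity by twice the empirical one.
  have e1 := (abs_lt.1 hns.1).2
  have e2 := (abs_lt.1 hns.2).1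
  have e3 : 3 * t / √(k : ℝ) = 3 * (t / √k) := by ring
  rw [e3] at hs
  linarith

/-- Two-sided uniform deviations for a class with a countable, pointwise sequentially dense
subclass, in terms of its (nonnegative) empirical Rademacher complexity. -/
theorem measure_uniform_deviation_le (hk : 0 < k) {H D : Set (S → ℝ)} (hDH : D ⊆ H)
    (hc : D.Countable)
    (hdense : ∀ h ∈ H, ∃ r : ℕ → S → ℝ, (∀ j, r j ∈ D) ∧
      ∀ x, Tendsto (fun j => r j x) atTop (𝓝 (h x)))
    (hm : ∀ h ∈ D, Measurable h) {T : Set S} (hT : MeasurableSet T) (hνT : ν Tᶜ = 0) {B : ℝ}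
    (hB : ∀ h ∈ H, ∀ x ∈ T, |h x| ≤ B) {t : ℝ} (ht : 0 < t) :
    (Measure.pi fun _ : Fin k => ν) {s | ¬ (0 ≤ empRademacher H s ∧ ∀ h ∈ H,
        |∫ x, h x ∂ν - (k : ℝ)⁻¹ * ∑ i, h (s i)| ≤ 2 * empRademacher H s + 3 * t / √k)}
      ≤ ENNReal.ofReal (16 * B ^ 2 / t ^ 2) := by
  rcases H.eq_empty_or_nonempty with rfl | ⟨h₀, hh₀⟩
  · simp [empRademacher]
  have hDne : D.Nonempty := by
    obtain ⟨r, hr, -⟩ := hdense h₀ hh₀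
    exact ⟨_, hr 0⟩
  have hTν : ∀ᵐ x ∂ν, x ∈ T := by rwa [ae_iff]
  have hTne : T.Nonempty := by
    obtain ⟨x, hx⟩ := hTν.exists
    exact ⟨x, hx⟩
  have hB0 : 0 ≤ B := (abs_nonneg _).trans (hB h₀ hh₀ _ hTne.some_mem)
  -- Cutting off outside T changes nothing almost surely and makes the class bounded everywhere; the
  -- negatives `D₂` supply the other side of the deviation.
  set D₁ : Set (S → ℝ) := (fun g => T.indicator g) '' D
  set D₂ : Set (S → ℝ) := (fun g => -g) '' D₁
  have hD₁ : D₁.Nonempty := hDne.image _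
  have hc₁ : D₁.Countable := hc.image _
  have hm₁ : ∀ h ∈ D₁, Measurable h := by
    rintro _ ⟨g, hg, rfl⟩
    exact (hm g hg).indicator hT
  have hB₁ : ∀ h ∈ D₁, ∀ x, |h x| ≤ B := by
    rintro _ ⟨g, hg, rfl⟩ x
    by_cases hx : x ∈ T
    · simpa [hx] using hB g (hDH hg) x hx
    · simpa [hx] using hB0
  have hm₂ : ∀ h ∈ D₂, Measurable h := by
    rintro _ ⟨g, hg, rfl⟩
    exact (hm₁ g hg).neg
  have hB₂ : ∀ h ∈ D₂, ∀ x, |h x| ≤ B := by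
    rintro _ ⟨g, hg, rfl⟩ x
    simpa using hB₁ g hg x
  have p₁ := measure_devSup_gt_le (ν := ν) hk hD₁ hc₁ hm₁ hB₁ ht
  have p₂ := measure_devSup_gt_le (ν := ν) hk (hD₁.image _) (hc₁.image _) hm₂ hB₂ ht
  have p₀ : (Measure.pi fun _ : Fin k => ν) {s | ¬ ∀ i, s i ∈ T} = 0 := by
    rw [← ae_iff, ae_all_iff]
    exact fun i => (measurePreserving_eval (fun _ : Fin k => ν) i).quasiMeasurePreserving.ae hTν
  have hsum : (16 * B ^ 2 / t ^ 2 : ℝ) = 8 * B ^ 2 / t ^ 2 + 8 * B ^ 2 / t ^ 2 := by ring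
  rw [hsum, ENNReal.ofReal_add (by positivity) (by positivity),
    ← zero_add (ENNReal.ofReal _ + _), ← p₀]
  refine (measure_mono fun s hs => ?_).trans ((measure_union_le _ _).trans
    (add_le_add le_rfl ((measure_union_le _ _).trans (add_le_add p₁ p₂))))
  by_contra hns
  simp only [Set.mem_union, Set.mem_ofPred_eq, not_or, not_lt, not_not] at hns
  obtain ⟨hsT, b₁, b₂⟩ := hns
  refine hs ⟨empRademacher_nonneg hh₀ hB0 hB hsT, ?_⟩
  -- On a sample inside T the cut-off is invisible, so `D₁` contributes only signed means already
  -- present in H. This inequality suffices; the complexity of the uncountable class H need not be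
  -- measurable, because the bad event is merely included in a union of small ones.
  have hR : empRademacher D₁ s ≤ empRademacher H s := by
    rw [empRademacher_eq_sum_signedSup, empRademacher_eq_sum_signedSup]
    refine mul_le_mul_of_nonneg_left (Finset.sum_le_sum fun σ _ => ?_) (by positivity)
    have : Nonempty D₁ := hD₁.to_subtype
    refine ciSup_le fun h => ?_
    obtain ⟨g, hg, hgh⟩ := h.2
    refine le_trans (le_of_eq ?_) (le_ciSup (bddAbove_signed hB0 hB σ hsT) ⟨g, hDH hg⟩)
    simp [← hgh, hsT]
  set b := 2 * empRademacher H s + 3 * t / √k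
  have b₁' : devSup ν D₁ s ≤ b := b₁.trans (by simp only [b]; linarith)
  have b₂' : devSup ν D₂ s ≤ b := b₂.trans (by
    rw [empRademacher_neg_image]; simp only [b]; linarith)
  have hmem : ∀ g ∈ D, |∫ x, T.indicator g x ∂ν - (k : ℝ)⁻¹ * ∑ i, g (s i)| ≤ b := by
    intro g hg
    have l₁ := le_ciSup (bddAbove_dev (ν := ν) hB₁ hD₁ s) ⟨_, Set.mem_image_of_mem _ hg⟩
    have l₂ := le_ciSup (bddAbove_dev (ν := ν) hB₂ (hD₁.image _) s)
      ⟨_, Set.mem_image_of_mem _ (Set.mem_image_of_mem _ hg)⟩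
    have l₁' := l₁.trans b₁'
    have l₂' := l₂.trans b₂'
    simp only [Pi.neg_apply, integral_neg, Finset.sum_neg_distrib, Set.indicator_of_mem (hsT _)]
      at l₁' l₂'
    rw [abs_le]; constructor <;> linarith
  intro h hh
  obtain ⟨r, hr, hrh⟩ := hdense h hh
  -- Dominated convergence with the constant B carries the bound from the countable subclass to all
  -- of H, on one and the same event.
  have hlim₁ : Tendsto (fun j => ∫ x, T.indicator (r j) x ∂ν) atTop (𝓝 (∫ x, h x ∂ν)) := by
    refine tendsto_integral_of_dominated_convergence (fun _ => B)
      (fun j => ((hm _ (hr j)).indicator hT).aestronglyMeasurable) (integrable_const _)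
      (fun j => ae_of_all _ fun x => hB₁ _ (Set.mem_image_of_mem _ (hr j)) x) ?_
    filter_upwards [hTν] with x hx
    simpa [hx] using hrh x
  have hlim₂ : Tendsto (fun j => (k : ℝ)⁻¹ * ∑ i, r j (s i)) atTop
      (𝓝 ((k : ℝ)⁻¹ * ∑ i, h (s i))) :=
    (tendsto_finsetSum _ fun i _ => hrh (s i)).const_mul _
  exact le_of_tendsto (hlim₁.sub hlim₂).abs (Eventually.of_forall fun j => hmem _ (hr j))

end UniformDeviation

/-- Jensen's inequality, in the form L¹ ≤ L² on a probability space. Integrability is not assumed: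
for a nonintegrable f the left side is 0 by convention. -/
lemma enorm_integral_sq_le {X : Type*} [MeasurableSpace X] {μ : Measure X}
    [IsProbabilityMeasure μ] {f : X → ℝ} (hf : AEStronglyMeasurable f μ) :
    ‖∫ x, f x ∂μ‖ₑ ^ 2 ≤ ∫⁻ x, ‖f x‖ₑ ^ 2 ∂μ := by
  have h1 : ‖∫ x, f x ∂μ‖ₑ ≤ eLpNorm f 2 μ := by
    refine (enorm_integral_le_lintegral_enorm f).trans ?_
    rw [← eLpNorm_one_eq_lintegral_enorm]
    exact eLpNorm_le_eLpNorm_of_exponent_le one_le_two hf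
  have h2 := eLpNorm_nnreal_pow_eq_lintegral (μ := μ) (f := f) (p := 2) two_ne_zero
  simp only [NNReal.coe_ofNat, ENNReal.rpow_ofNat, ENNReal.coe_ofNat] at h2
  rw [← h2]
  gcongr

lemma eLpNorm_two_sq {X : Type*} [MeasurableSpace X] {μ : Measure X} (f : X → ℝ) :
    eLpNorm f 2 μ ^ 2 = ∫⁻ x, ‖f x‖ₑ ^ 2 ∂μ := by
  have h2 := eLpNorm_nnreal_pow_eq_lintegral (μ := μ) (f := f) (p := 2) two_ne_zero
  simpa only [NNReal.coe_ofNat, ENNReal.rpow_ofNat, ENNReal.coe_ofNat] using h2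

lemma memLp_two_of_lintegral_lt_top {X : Type*} [MeasurableSpace X] {μ : Measure X} {f : X → ℝ}
    (hf : AEStronglyMeasurable f μ) (h : ∫⁻ x, ‖f x‖ₑ ^ 2 ∂μ < ∞) : MemLp f 2 μ := by
  refine ⟨hf, ?_⟩
  rw [← eLpNorm_two_sq] at h
  by_contra hc
  rw [not_lt_top_iff] at hc
  simp [hc] at h

/-! ### Identification of the structural function by a bridge function -/

namespace Population

variable {Ω 𝒰 𝒜 𝒵 𝒲 : Type*} [MeasurableSpace Ω] [MeasurableSpace 𝒰]
    [MeasurableSpace 𝒜] [MeasurableSpace 𝒵] [MeasurableSpace 𝒲] (P : Population Ω 𝒰 𝒜 𝒵 𝒲)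

instance : IsProbabilityMeasure P.lawA := Measure.isProbabilityMeasure_map P.measA.aemeasurable
instance : IsProbabilityMeasure P.lawU := Measure.isProbabilityMeasure_map P.measU.aemeasurable
instance : IsProbabilityMeasure P.lawW := Measure.isProbabilityMeasure_map P.measW.aemeasurable
instance : IsProbabilityMeasure P.lawWAZ :=
  Measure.isProbabilityMeasure_map
    (P.measW.prodMk (P.measA.prodMk P.measZ)).aemeasurable
instance : IsProbabilityMeasure P.lawYAZ :=
  Measure.isProbabilityMeasure_map
    (P.measY.prodMk (P.measA.prodMk P.measZ)).aemeasurable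

lemma nonempty_sample (P : Population Ω 𝒰 𝒜 𝒵 𝒲) : Nonempty Ω := nonempty_of_isProbabilityMeasure P.μ

/-- The support condition, for integrals. -/
lemma GoodSupport.lintegral_le {P : Population Ω 𝒰 𝒜 𝒵 𝒲} {η : ℝ} (h : P.GoodSupport η)
    {f : 𝒜 × 𝒲 → ℝ≥0∞} (hf : Measurable f) :
    ∫⁻ x, f x ∂(P.lawA.prod P.lawW) ≤ ENNReal.ofReal η * ∫⁻ ω, f (P.A ω, P.W ω) ∂P.μ := by
  refine (lintegral_mono' h le_rfl).trans ?_
  rw [lintegral_smul_measure, lawAW, lintegral_map hf (P.measA.prodMk P.measW), smul_eq_mul]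

lemma comap_AZ_le_of {χ : Type*} [MeasurableSpace χ] {X : Ω → χ} {φ : χ → 𝒜 × 𝒵}
    (hφ : Measurable φ) (hX : (fun ω => (P.A ω, P.Z ω)) = φ ∘ X) :
    MeasurableSpace.comap (fun ω => (P.A ω, P.Z ω)) inferInstance
      ≤ MeasurableSpace.comap X inferInstance := by
  rw [hX, ← MeasurableSpace.comap_comp]
  exact MeasurableSpace.comap_mono hφ.comap_le

/-- Completeness for `X` forces `P_A ⊗ P_X` to be absolutely continuous with respect to the joint
law of `(A, X)`. -/
lemma CompleteFor.absolutelyContinuous {P : Population Ω 𝒰 𝒜 𝒵 𝒲} {χ : Type*}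
    [MeasurableSpace χ] {X : Ω → χ} (hX : Measurable X) (h : P.CompleteFor X) :
    P.lawA.prod (P.μ.map X) ≪ P.μ.map (fun ω => (P.A ω, X ω)) := by
  have : IsProbabilityMeasure (P.μ.map X) := Measure.isProbabilityMeasure_map hX.aemeasurable
  refine Measure.AbsolutelyContinuous.mk fun N hN h0 => ?_
  rw [Measure.map_apply (P.measA.prodMk hX) hN] at h0
  -- Test completeness on the indicator of a set that is null for the joint law: its conditional
  -- expectation vanishes, so it is null for the product law too.
  have hl : Measurable (N.indicator fun _ => (1 : ℝ)) := measurable_const.indicator hN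
  have hlB : ∀ x, |N.indicator (fun _ => (1 : ℝ)) x| ≤ 1 := fun x => by
    by_cases hx : x ∈ N <;> simp [hx]
  have hz : (fun ω => N.indicator (fun _ => (1 : ℝ)) (P.A ω, X ω)) =ᵐ[P.μ] 0 := by
    filter_upwards [measure_eq_zero_iff_ae_notMem.1 h0] with ω hω
    simpa using hω
  have := h _ hl (memLp_of_abs_le hl hlB)
    (memLp_of_abs_le (hl.comp (P.measA.prodMk hX)) fun ω => hlB _)
    ((condExp_congr_ae hz).trans (by rw [condExp_zero]))
  rw [measure_eq_zero_iff_ae_notMem]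
  filter_upwards [this] with x hx hxN
  simp [hxN] at hx

/-- The support condition transports square integrability from the joint law of (A, W) to the
product of the marginals, where Fubini and the averages over W take place. -/
lemma IsBridge.lintegral_prod_lt_top {P : Population Ω 𝒰 𝒜 𝒵 𝒲} {h : 𝒜 → 𝒲 → ℝ}
    (hb : P.IsBridge h) {η : ℝ} (hη : P.GoodSupport η) :
    ∫⁻ x, ‖h x.1 x.2‖ₑ ^ 2 ∂(P.lawA.prod P.lawW) < ∞ := by
  refine (hη.lintegral_le (hb.measurable.enorm.pow_const 2)).trans_lt
    (ENNReal.mul_lt_top ENNReal.ofReal_lt_top ?_)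
  have := eLpNorm_two_sq (μ := P.μ) (fun ω => h (P.A ω) (P.W ω))
  rw [← this]
  exact ENNReal.pow_lt_top hb.memLp.2

/-- Ensures that the average of h(a, ·) over the law of W is a genuine integral, and not the default
value 0, for almost every a. -/
lemma IsBridge.ae_integrable {P : Population Ω 𝒰 𝒜 𝒵 𝒲} {h : 𝒜 → 𝒲 → ℝ} (hb : P.IsBridge h)
    {η : ℝ} (hη : P.GoodSupport η) : ∀ᵐ a ∂P.lawA, Integrable (h a) P.lawW :=
  ((memLp_two_of_lintegral_lt_top hb.measurable.aestronglyMeasurable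
    (hb.lintegral_prod_lt_top hη)).integrable one_le_two).prod_right_ae

/-- Identification: a bridge function determines the structural function. -/
theorem fStruct_ae_eq [StandardBorelSpace Ω] [StandardBorelSpace 𝒵] [StandardBorelSpace 𝒜]
    [StandardBorelSpace 𝒲] (hS : P.Structural) (hU : P.CompleteFor P.U)
    {h : 𝒜 → 𝒲 → ℝ} (hb : P.IsBridge h) {M η : ℝ} (hY : ∀ᵐ ω ∂P.μ, |P.Y ω| ≤ M)
    (hη : P.GoodSupport η) :
    ∀ᵐ a ∂P.lawA, P.fStruct a = ∫ w, h a w ∂P.lawW := by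
  obtain ⟨ω₀⟩ := P.nonempty_sample
  have : Nonempty 𝒵 := ⟨P.Z ω₀⟩
  have : Nonempty 𝒜 := ⟨P.A ω₀⟩
  have : Nonempty 𝒲 := ⟨P.W ω₀⟩
  have hA := P.measA
  have hUm := P.measU
  have hZ := P.measZ
  have hW := P.measW
  have hYm := P.measY
  have hYi : Integrable P.Y P.μ :=
    Integrable.of_bound P.measY.aestronglyMeasurable M (by simpa using hY)
  set κY := condDistrib P.Y (fun ω => (P.A ω, P.U ω)) P.μ with hκY
  set κW := condDistrib P.W P.U P.μ with hκW
  set e : 𝒜 × 𝒰 → ℝ := fun x => ∫ y, y ∂κY x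
  set g : 𝒜 × 𝒰 → ℝ := fun x => ∫ w, h x.1 w ∂κW x.2
  have he : Measurable e :=
    (StronglyMeasurable.integral_kernel (κ := κY) stronglyMeasurable_id).measurable
  have hg : Measurable g := by
    have : StronglyMeasurable (Function.uncurry fun (x : 𝒜 × 𝒰) (w : 𝒲) => h x.1 w) :=
      (hb.measurable.comp (f := fun y : (𝒜 × 𝒰) × 𝒲 => (y.1.1, y.2))
        (by fun_prop)).stronglyMeasurable
    exact (this.integral_kernel_prod_right (κ := κW.comap Prod.snd measurable_snd)).measurable
  -- the regression of `Y`
  have hcY : P.condAZ (fun ω => e (P.A ω, P.U ω)) =ᵐ[P.μ] P.condAZ P.Y := by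
    -- Given (A, U), the proxy Z can be dropped from the conditional law of Y. So e(A, U) is also
    -- the regression on (A, U, Z), and the tower property projects it to (A, Z).
    have h1 := (condIndepFun_iff_condDistrib_prod_ae_eq_prodMkRight hYm hZ (hA.prodMk hUm)).1
      hS.1.symm
    have h2 := condExp_ae_eq_integral_condDistrib'
      (X := fun ω => ((P.A ω, P.U ω), P.Z ω)) ((hA.prodMk hUm).prodMk hZ) hYi
    have h3 := ae_of_ae_map ((hA.prodMk hUm).prodMk hZ).aemeasurable h1
    have h4 : (fun ω => e (P.A ω, P.U ω)) =ᵐ[P.μ]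
        P.μ[P.Y | MeasurableSpace.comap (fun ω => ((P.A ω, P.U ω), P.Z ω)) inferInstance] := by
      filter_upwards [h2, h3] with ω w2 w3
      rw [w2, w3]
      rfl
    refine (condExp_congr_ae h4).trans (condExp_condExp_of_le ?_ ?_)
    · exact P.comap_AZ_le_of (φ := fun x : (𝒜 × 𝒰) × 𝒵 => (x.1.1, x.2)) (by fun_prop) rfl
    · exact ((hA.prodMk hUm).prodMk hZ).comap_le
  -- the regression of the bridge function
  have hhi : Integrable (fun ω => h (P.A ω) (P.W ω)) P.μ := hb.memLp.integrable one_le_two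
  have h4 : (fun ω => g (P.A ω, P.U ω)) =ᵐ[P.μ] P.μ[fun ω => h (P.A ω) (P.W ω) |
      MeasurableSpace.comap (fun ω => (P.U ω, (P.A ω, P.Z ω))) inferInstance] := by
    -- Given U, the conditional law of W does not involve (A, Z); hence g(A, U) is the regression of
    -- h(A, W) on (U, A, Z), with A frozen inside the kernel.
    have h1 := (condIndepFun_iff_condDistrib_prod_ae_eq_prodMkRight hW (hA.prodMk hZ) hUm).1
      hS.2.symm
    have h2 := condExp_prod_ae_eq_integral_condDistrib
      (X := fun ω => (P.U ω, (P.A ω, P.Z ω))) (Y := P.W) (μ := P.μ)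
      (f := fun x : (𝒰 × (𝒜 × 𝒵)) × 𝒲 => h x.1.2.1 x.2) (hUm.prodMk (hA.prodMk hZ))
      hW.aemeasurable (hb.measurable.comp
        (f := fun x : (𝒰 × (𝒜 × 𝒵)) × 𝒲 => (x.1.2.1, x.2)) (by fun_prop)).stronglyMeasurable hhi
    have h3 := ae_of_ae_map (hUm.prodMk (hA.prodMk hZ)).aemeasurable h1
    filter_upwards [h2, h3] with ω w2 w3
    rw [w2, w3]
    rfl
  have hcW : P.condAZ (fun ω => g (P.A ω, P.U ω)) =ᵐ[P.μ]
      P.condAZ (fun ω => h (P.A ω) (P.W ω)) := by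
    refine (condExp_congr_ae h4).trans (condExp_condExp_of_le ?_ ?_)
    · exact P.comap_AZ_le_of (φ := fun x : 𝒰 × (𝒜 × 𝒵) => x.2) (by fun_prop) rfl
    · exact (hUm.prodMk (hA.prodMk hZ)).comap_le
  -- square integrability
  have heB : ∀ᵐ ω ∂P.μ, |e (P.A ω, P.U ω)| ≤ M := by
    filter_upwards [ae_bdd_abs_condExp_of_ae_bdd_abs
      (m := MeasurableSpace.comap (fun ω => (P.A ω, P.U ω)) inferInstance) hY,
      condExp_ae_eq_integral_condDistrib' (hA.prodMk hUm) hYi] with ω w1 w2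
    rwa [w2] at w1
  -- The bound on e is known only almost surely for the joint law of (A, U). The absolute continuity
  -- implied by completeness carries it to the product law.
  have heB' : ∀ᵐ x ∂(P.lawA.prod P.lawU), |e x| ≤ M := by
    refine (hU.absolutelyContinuous hUm).ae_le ?_
    exact (ae_map_iff (hA.prodMk hUm).aemeasurable (measurableSet_le
      (continuous_abs.measurable.comp he) measurable_const)).2 heB
  have he1 : MemLp e 2 (P.lawA.prod P.lawU) :=
    MemLp.of_bound he.aestronglyMeasurable M heB'
  have he2 : MemLp (fun ω => e (P.A ω, P.U ω)) 2 P.μ :=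
    MemLp.of_bound (he.comp (hA.prodMk hUm)).aestronglyMeasurable M heB
  have hg2 : MemLp (fun ω => g (P.A ω, P.U ω)) 2 P.μ := (hb.memLp.condExp one_le_two).ae_eq h4.symm
  have hsq : Measurable fun x : 𝒜 × 𝒲 => ‖h x.1 x.2‖ₑ ^ 2 := hb.measurable.enorm.pow_const 2
  have hh1 := hb.lintegral_prod_lt_top hη
  -- Mixing the conditional laws of W over U returns the law of W. With Jensen on each fibre, this
  -- bounds the norm of g by that of h for the product laws.
  have hlaw : κW ∘ₘ P.lawU = P.lawW := condDistrib_comp_map hUm.aemeasurable hW.aemeasurable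
  have hha : ∀ a, Measurable (h a) := fun a => hb.measurable.comp measurable_prodMk_left
  have hg1 : MemLp g 2 (P.lawA.prod P.lawU) := by
    refine memLp_two_of_lintegral_lt_top hg.aestronglyMeasurable (lt_of_le_of_lt ?_ hh1)
    rw [lintegral_prod _ (by fun_prop), lintegral_prod _ hsq.aemeasurable]
    refine lintegral_mono fun a => ?_
    calc ∫⁻ u, ‖g (a, u)‖ₑ ^ 2 ∂P.lawU
        ≤ ∫⁻ u, ∫⁻ w, ‖h a w‖ₑ ^ 2 ∂(κW u) ∂P.lawU :=
          lintegral_mono fun u => enorm_integral_sq_le (hha a).aestronglyMeasurable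
      _ = ∫⁻ w, ‖h a w‖ₑ ^ 2 ∂P.lawW := by
          rw [← hlaw, Measure.lintegral_bind κW.aemeasurable
            ((hha a).enorm.pow_const 2).aemeasurable]
  -- completeness
  have hzero : P.condAZ (fun ω => (e - g) (P.A ω, P.U ω)) =ᵐ[P.μ] 0 := by
    have h1 : P.condAZ (fun ω => (e - g) (P.A ω, P.U ω)) =ᵐ[P.μ]
        P.condAZ (fun ω => e (P.A ω, P.U ω)) - P.condAZ (fun ω => g (P.A ω, P.U ω)) :=
      condExp_sub (he2.integrable one_le_two) (hg2.integrable one_le_two) _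
    filter_upwards [h1, hcY, hcW, hb.bridge] with ω w1 w2 w3 w4
    rw [w1, Pi.sub_apply, w2, w3, w4]
    simp
  have hl := hU (e - g) (he.sub hg) (he1.sub hg1) (he2.sub hg2) hzero
  have hsnd : ∀ a, Measurable fun x : 𝒰 × 𝒲 => h a x.2 := fun a => (hha a).comp measurable_snd
  filter_upwards [Measure.ae_ae_of_ae_prod hl, hb.ae_integrable hη] with a ha hai
  calc P.fStruct a = ∫ u, g (a, u) ∂P.lawU := by
        refine integral_congr_ae ?_
        filter_upwards [ha] with u hu
        have : e (a, u) - g (a, u) = 0 := hu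
        exact sub_eq_zero.1 this
    _ = ∫ x, h a x.2 ∂(P.lawU ⊗ₘ κW) := by
        refine (Measure.integral_compProd (f := fun x : 𝒰 × 𝒲 => h a x.2) ?_).symm
        rw [lawU, hκW, compProd_map_condDistrib hW.aemeasurable]
        refine (integrable_map_measure ?_ (hUm.prodMk hW).aemeasurable).2 ?_
        · exact (hsnd a).aestronglyMeasurable
        · exact (integrable_map_measure (hha a).aestronglyMeasurable hW.aemeasurable).1 hai
    _ = ∫ w, h a w ∂P.lawW := by
        rw [lawU, hκW, compProd_map_condDistrib hW.aemeasurable, lawW,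
          integral_map (hUm.prodMk hW).aemeasurable
            (hsnd a).aestronglyMeasurable,
          integral_map hW.aemeasurable (hha a).aestronglyMeasurable]

end Population

/-! ### Euclidean norms, bounds on the losses, countable dense subclasses -/

section SqNorm

variable {ι : Type*} [Fintype ι]

lemma sqNorm_nonneg (x : ι → ℝ) : 0 ≤ sqNorm x := Finset.sum_nonneg fun _ _ => sq_nonneg _

lemma sqNorm_smul (c : ℝ) (x : ι → ℝ) : sqNorm (c • x) = c ^ 2 * sqNorm x := by
  simp [sqNorm, mul_pow, Finset.mul_sum]

lemma sqNorm_eq_zero {x : ι → ℝ} (h : sqNorm x = 0) : x = 0 := by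
  ext i
  have := (Finset.sum_eq_zero_iff_of_nonneg fun i _ => sq_nonneg (x i)).1 h i (Finset.mem_univ i)
  simpa using this

lemma sqNorm_sub_le (x y : ι → ℝ) : sqNorm (x - y) ≤ 2 * (sqNorm x + sqNorm y) := by
  simp only [sqNorm, ← Finset.sum_add_distrib, Finset.mul_sum, Pi.sub_apply]
  exact Finset.sum_le_sum fun i _ => by nlinarith [sq_nonneg (x i + y i)]

lemma sqNorm_le_of_sqrt_le {x : ι → ℝ} {M : ℝ} (h : √(sqNorm x) ≤ M) : sqNorm x ≤ M ^ 2 :=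
  (Real.sqrt_le_left ((Real.sqrt_nonneg _).trans h)).1 h

lemma sq_apply_le_sqNorm (x : ι → ℝ) (i : ι) : x i ^ 2 ≤ sqNorm x :=
  Finset.single_le_sum (f := fun i => x i ^ 2) (fun _ _ => sq_nonneg _) (Finset.mem_univ i)

lemma measurable_sqNorm {X : Type*} [MeasurableSpace X] {f : X → ι → ℝ}
    (hf : ∀ i, Measurable fun x => f x i) : Measurable fun x => sqNorm (f x) :=
  Finset.measurable_sum _ fun i _ => (hf i).pow_const 2

lemma tendsto_sqNorm {f : ℕ → ι → ℝ} {x : ι → ℝ} (h : Tendsto f atTop (𝓝 x)) :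
    Tendsto (fun k => sqNorm (f k)) atTop (𝓝 (sqNorm x)) :=
  tendsto_finsetSum _ fun i _ => ((tendsto_pi_nhds.1 h) i).pow 2

end SqNorm

namespace Model

variable {Ω 𝒰 𝒜 𝒵 𝒲 ΘA1 ΘZ ΘA2 ΘW : Type*} [MeasurableSpace Ω] [MeasurableSpace 𝒰]
    [MeasurableSpace 𝒜] [MeasurableSpace 𝒵] [MeasurableSpace 𝒲] {pA pZ qA d : ℕ}
    (F : Model 𝒜 𝒵 𝒲 ΘA1 ΘZ ΘA2 ΘW pA pZ qA d)

/-- The coefficients of the linear form of stage 2. -/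
def lin2Coef (p : Param2 ΘA2 ΘW qA d) (j : Fin d) (a : 𝒜) : ℝ :=
  ∑ i, p.u (i, j) * F.ψA p.θA a i

/-- Isolates coefficients that depend on a alone. This gives linearity in v, and later lets the form
be pulled out of a conditional expectation given (A, Z). -/
lemma lin2_eq_sum (p : Param2 ΘA2 ΘW qA d) (a : 𝒜) (v : Fin d → ℝ) :
    F.lin2 p a v = ∑ j, F.lin2Coef p j a * v j := by
  simp only [lin2, dotProduct, kron, Fintype.sum_prod_type_right, lin2Coef, Finset.sum_mul]
  exact Finset.sum_congr rfl fun j _ => Finset.sum_congr rfl fun i _ => by ring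

lemma lin2_sub (p : Param2 ΘA2 ΘW qA d) (a : 𝒜) (v w : Fin d → ℝ) :
    F.lin2 p a (v - w) = F.lin2 p a v - F.lin2 p a w := by
  simp [lin2_eq_sum, mul_sub, Finset.sum_sub_distrib]

lemma lin2_smul (p : Param2 ΘA2 ΘW qA d) (a : 𝒜) (c : ℝ) (v : Fin d → ℝ) :
    F.lin2 p a (c • v) = c * F.lin2 p a v := by
  simp only [lin2_eq_sum, Finset.mul_sum, Pi.smul_apply, smul_eq_mul]
  exact Finset.sum_congr rfl fun j _ => by ring

lemma lin2_sum {ι : Type*} (s : Finset ι) (p : Param2 ΘA2 ΘW qA d) (a : 𝒜) (v : ι → Fin d → ℝ) :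
    F.lin2 p a (∑ i ∈ s, v i) = ∑ i ∈ s, F.lin2 p a (v i) := by
  simp only [lin2_eq_sum, Finset.sum_apply, Finset.mul_sum]
  exact Finset.sum_comm

/-- By linearity, inserting the mean of the features is averaging the bridge function over the extra
sample. -/
lemma fHat_eq (p : Param2 ΘA2 ΘW qA d) {k : ℕ} (w : Fin k → 𝒲) (a : 𝒜) :
    F.fHat p w a = (k : ℝ)⁻¹ * ∑ i, F.bridge p a (w i) := by
  rw [fHat, lin2_smul, lin2_sum]
  rfl

lemma measurable_lin2Coef (p : Param2 ΘA2 ΘW qA d) (j : Fin d) : Measurable (F.lin2Coef p j) := by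
  have := fun i => (measurable_pi_apply i).comp (F.meas_ψA p.θA)
  exact Finset.measurable_sum _ fun i _ => (this i).const_mul _

lemma measurable_ψW (θ : ΘW) (i : Fin d) : Measurable fun w => F.ψW θ w i :=
  (measurable_pi_apply i).comp (F.meas_ψW θ)

lemma measurable_pred1 (q : Param1 ΘA1 ΘZ pA pZ d) (i : Fin d) :
    Measurable fun x : 𝒜 × 𝒵 => F.pred1 q x.1 x.2 i := by
  have h1 := fun i => (measurable_pi_apply i).comp (F.meas_φA q.θA)
  have h2 := fun i => (measurable_pi_apply i).comp (F.meas_φZ q.θZ)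
  refine Finset.measurable_sum _ fun ij _ => Measurable.const_mul ?_ _
  exact ((h1 ij.1).comp measurable_fst).mul ((h2 ij.2).comp measurable_snd)

lemma measurable_lin2 {X : Type*} [MeasurableSpace X] (p : Param2 ΘA2 ΘW qA d) {a : X → 𝒜}
    {v : X → Fin d → ℝ} (ha : Measurable a) (hv : ∀ j, Measurable fun x => v x j) :
    Measurable fun x => F.lin2 p (a x) (v x) := by
  simp_rw [lin2_eq_sum]
  exact Finset.measurable_sum _ fun j _ => ((F.measurable_lin2Coef p j).comp ha).mul (hv j)

lemma measurable_bridge (p : Param2 ΘA2 ΘW qA d) :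
    Measurable fun x : 𝒜 × 𝒲 => F.bridge p x.1 x.2 :=
  F.measurable_lin2 p measurable_fst fun j => (F.measurable_ψW p.θW j).comp measurable_snd

lemma measurable_loss1 (θ : ΘW) (q : Param1 ΘA1 ΘZ pA pZ d) : Measurable (F.loss1 θ q) :=
  measurable_sqNorm fun i => ((F.measurable_ψW θ i).comp measurable_fst).sub
    ((F.measurable_pred1 q i).comp measurable_snd)

lemma measurable_loss2 (p : Param2 ΘA2 ΘW qA d) (q : Param1 ΘA1 ΘZ pA pZ d) :
    Measurable (F.loss2 p q) :=
  (measurable_fst.sub (F.measurable_lin2 p (measurable_fst.comp measurable_snd)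
    fun j => (F.measurable_pred1 q j).comp measurable_snd)).pow_const 2

/-- Pointwise separability of the model gives a countable dense subclass of `H₁`. -/
lemma exists_dense_class1 (hsep : F.PointwiseSeparable) :
    ∃ D ⊆ F.class1, D.Countable ∧ (∀ h ∈ D, Measurable h) ∧
      ∀ h ∈ F.class1, ∃ r : ℕ → 𝒲 × 𝒜 × 𝒵 → ℝ, (∀ j, r j ∈ D) ∧
        ∀ x, Tendsto (fun j => r j x) atTop (𝓝 (h x)) := by
  obtain ⟨⟨D₁, hD₁, hc₁, hd₁⟩, D₂, hD₂, hc₂, hd₂⟩ := hsep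
  refine ⟨(fun x : Param2 ΘA2 ΘW qA d × Param1 ΘA1 ΘZ pA pZ d => F.loss1 x.1.θW x.2) '' (D₂ ×ˢ D₁),
    ?_, (hc₂.prod hc₁).image _, ?_, ?_⟩
  · rintro _ ⟨⟨p, q⟩, ⟨hp, hq⟩, rfl⟩
    exact ⟨p, hD₂ hp, q, hD₁ hq, rfl⟩
  · rintro _ ⟨⟨p, q⟩, -, rfl⟩
    exact F.measurable_loss1 _ _
  · rintro _ ⟨p, hp, q, hq, rfl⟩
    obtain ⟨r₁, hr₁, hl₁⟩ := hd₁ q hq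
    obtain ⟨r₂, hr₂, hl₂, -⟩ := hd₂ p hp
    exact ⟨fun j => F.loss1 (r₂ j).θW (r₁ j), fun j => ⟨(r₂ j, r₁ j), ⟨hr₂ j, hr₁ j⟩, rfl⟩,
      fun x => tendsto_sqNorm ((hl₂ x.1).sub (hl₁ x.2.1 x.2.2))⟩

namespace BoundedBy

variable {F} {P : Population Ω 𝒰 𝒜 𝒵 𝒲} {M : ℝ}

lemma nonneg (h : F.BoundedBy P M) : 0 ≤ M := by
  obtain ⟨ω, hω⟩ := h.outcome.exists
  exact (abs_nonneg _).trans hω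

lemma sqNorm_pred1 (h : F.BoundedBy P M) {q} (hq : q ∈ F.adm1) (a : 𝒜) (z : 𝒵) :
    sqNorm (F.pred1 q a z) ≤ M ^ 2 := sqNorm_le_of_sqrt_le (h.stage1 q hq a z)

lemma sqNorm_ψW (h : F.BoundedBy P M) {p} (hp : p ∈ F.adm2) (w : 𝒲) :
    sqNorm (F.ψW p.θW w) ≤ M ^ 2 := sqNorm_le_of_sqrt_le (h.feature p hp w)

/-- Homogeneity extends the bound from the unit ball; the zero vector, which cannot be normalized,
is treated apart. -/
lemma abs_lin2_le (h : F.BoundedBy P M) {p} (hp : p ∈ F.adm2) (a : 𝒜) (v : Fin d → ℝ) :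
    |F.lin2 p a v| ≤ M * √(sqNorm v) := by
  rcases (sqNorm_nonneg v).eq_or_lt with h0 | h0
  · rw [sqNorm_eq_zero h0.symm]
    simp [lin2_eq_sum, sqNorm]
  have hs : 0 < √(sqNorm v) := Real.sqrt_pos.2 h0
  have h1 := h.weight p hp a ((√(sqNorm v))⁻¹ • v) (by
    rw [sqNorm_smul, inv_pow, Real.sq_sqrt h0.le, inv_mul_cancel₀ h0.ne'])
  rw [lin2_smul, abs_mul, abs_of_pos (inv_pos.2 hs), inv_mul_le_iff₀ hs] at h1
  linarith

lemma sq_lin2_le (h : F.BoundedBy P M) {p} (hp : p ∈ F.adm2) (a : 𝒜) (v : Fin d → ℝ) :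
    F.lin2 p a v ^ 2 ≤ M ^ 2 * sqNorm v := by
  have h1 := pow_le_pow_left₀ (abs_nonneg _) (h.abs_lin2_le hp a v) 2
  rwa [sq_abs, mul_pow, Real.sq_sqrt (sqNorm_nonneg v)] at h1

lemma abs_bridge_le (h : F.BoundedBy P M) {p} (hp : p ∈ F.adm2) (a : 𝒜) (w : 𝒲) :
    |F.bridge p a w| ≤ M ^ 2 := by
  refine (h.abs_lin2_le hp a _).trans ?_
  rw [pow_two]
  exact mul_le_mul_of_nonneg_left (h.feature p hp w) h.nonneg

lemma abs_lin2_pred1_le (h : F.BoundedBy P M) {p} (hp : p ∈ F.adm2) {q} (hq : q ∈ F.adm1)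
    (a : 𝒜) (z : 𝒵) : |F.lin2 p a (F.pred1 q a z)| ≤ M ^ 2 := by
  refine (h.abs_lin2_le hp a _).trans ?_
  rw [pow_two]
  exact mul_le_mul_of_nonneg_left (h.stage1 q hq a z) h.nonneg

lemma abs_lin2Coef_le (h : F.BoundedBy P M) {p} (hp : p ∈ F.adm2) (j : Fin d) (a : 𝒜) :
    |F.lin2Coef p j a| ≤ M := by
  have := h.weight p hp a (Pi.single j 1) (by simp [sqNorm, Pi.single_apply])
  simpa [lin2_eq_sum, Pi.single_apply] using this

lemma abs_loss1_le (h : F.BoundedBy P M) {f} (hf : f ∈ F.class1) (x : 𝒲 × 𝒜 × 𝒵) :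
    |f x| ≤ 4 * M ^ 2 := by
  obtain ⟨p, hp, q, hq, rfl⟩ := hf
  rw [loss1, abs_of_nonneg (sqNorm_nonneg _)]
  have := h.sqNorm_pred1 hq x.2.1 x.2.2
  have := h.sqNorm_ψW hp x.1
  have := sqNorm_sub_le (F.ψW p.θW x.1) (F.pred1 q x.2.1 x.2.2)
  linarith

/-- The residual is at most M + M², the prediction being bounded by M². The restriction on x is
needed because the outcome is bounded only almost surely. -/
lemma abs_loss2_le (h : F.BoundedBy P M) {f} (hf : f ∈ F.class2) (x : ℝ × 𝒜 × 𝒵)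
    (hx : x ∈ {x : ℝ × 𝒜 × 𝒵 | |x.1| ≤ M}) : |f x| ≤ (M + M ^ 2) ^ 2 := by
  obtain ⟨p, hp, q, hq, rfl⟩ := hf
  rw [loss2, abs_of_nonneg (sq_nonneg _), ← sq_abs]
  have h1 : |x.1| ≤ M := hx
  have h2 := h.abs_lin2_pred1_le hp hq x.2.1 x.2.2
  exact pow_le_pow_left₀ (abs_nonneg _) ((abs_sub _ _).trans (add_le_add h1 h2)) 2

lemma lawYAZ_compl (h : F.BoundedBy P M) : P.lawYAZ {x : ℝ × 𝒜 × 𝒵 | |x.1| ≤ M}ᶜ = 0 := by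
  have hm : Measurable fun ω => (P.Y ω, P.A ω, P.Z ω) := P.measY.prodMk (P.measA.prodMk P.measZ)
  have hs : MeasurableSet {x : ℝ × 𝒜 × 𝒵 | |x.1| ≤ M} :=
    measurableSet_le (continuous_abs.measurable.comp measurable_fst) measurable_const
  rw [Population.lawYAZ, Measure.map_apply hm hs.compl]
  exact h.outcome

/-- Pointwise separability of the model gives a countable dense subclass of `H₂`. -/
lemma exists_dense_class2 (h : F.BoundedBy P M) (hsep : F.PointwiseSeparable) :
    ∃ D ⊆ F.class2, D.Countable ∧ (∀ h ∈ D, Measurable h) ∧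
      ∀ h ∈ F.class2, ∃ r : ℕ → ℝ × 𝒜 × 𝒵 → ℝ, (∀ j, r j ∈ D) ∧
        ∀ x, Tendsto (fun j => r j x) atTop (𝓝 (h x)) := by
  obtain ⟨⟨D₁, hD₁, hc₁, hd₁⟩, D₂, hD₂, hc₂, hd₂⟩ := hsep
  refine ⟨(fun x : Param2 ΘA2 ΘW qA d × Param1 ΘA1 ΘZ pA pZ d => F.loss2 x.1 x.2) '' (D₂ ×ˢ D₁),
    ?_, (hc₂.prod hc₁).image _, ?_, ?_⟩
  · rintro _ ⟨⟨p, q⟩, ⟨hp, hq⟩, rfl⟩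
    exact ⟨p, hD₂ hp, q, hD₁ hq, rfl⟩
  · rintro _ ⟨⟨p, q⟩, -, rfl⟩
    exact F.measurable_loss2 _ _
  · rintro _ ⟨p, hp, q, hq, rfl⟩
    obtain ⟨r₁, hr₁, hl₁⟩ := hd₁ q hq
    obtain ⟨r₂, hr₂, -, hl₂⟩ := hd₂ p hp
    refine ⟨fun j => F.loss2 (r₂ j) (r₁ j), fun j => ⟨(r₂ j, r₁ j), ⟨hr₂ j, hr₁ j⟩, rfl⟩,
      fun x => Tendsto.pow (tendsto_const_nhds.sub ?_) 2⟩
    set v := F.pred1 q x.2.1 x.2.2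
    -- Form and argument vary together along the sequence. The forms are M-Lipschitz uniformly in j,
    -- so the argument may be frozen at its limit v.
    have h1 : Tendsto (fun j => F.lin2 (r₂ j) x.2.1 (F.pred1 (r₁ j) x.2.1 x.2.2 - v)) atTop
        (𝓝 0) := by
      have h2 : Tendsto (fun j => F.pred1 (r₁ j) x.2.1 x.2.2 - v) atTop (𝓝 (v - v)) :=
        (hl₁ x.2.1 x.2.2).sub_const v
      have h3 := ((tendsto_sqNorm h2).sqrt).const_mul M
      have h4 : M * √(sqNorm (v - v)) = 0 := by simp [sqNorm]
      rw [h4] at h3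
      exact squeeze_zero_norm (fun j => h.abs_lin2_le (hD₂ (hr₂ j)) _ _) h3
    have h5 := h1.add (hl₂ x.2.1 v)
    rw [zero_add] at h5
    refine h5.congr fun j => ?_
    rw [lin2_sub]
    ring

end BoundedBy

end Model

/-- No signs are required, as the root of a negative number is 0; the deviation terms to which it is
applied carry no sign hypothesis. -/
lemma sqrt_add_le_sqrt_add_sqrt (a b : ℝ) : √(a + b) ≤ √a + √b := by
  have hle : ∀ x : ℝ, x ≤ √x ^ 2 := fun x => by
    rcases le_total 0 x with hx | hx
    · rw [Real.sq_sqrt hx]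
    · exact hx.trans (sq_nonneg _)
  have ha := Real.sqrt_nonneg a
  have hb := Real.sqrt_nonneg b
  refine Real.sqrt_le_iff.2 ⟨by positivity, ?_⟩
  nlinarith [hle a, hle b, mul_nonneg ha hb]

/-! ### Minkowski and Pythagoras in L² -/

section L2

variable {X : Type*} {mX : MeasurableSpace X} {μ : Measure X}

lemma eLpNorm_two_eq_ofReal_sqrt {f : X → ℝ} (hf : MemLp f 2 μ) :
    eLpNorm f 2 μ = ENNReal.ofReal √(∫ x, f x ^ 2 ∂μ) := by
  have h0 : 0 ≤ ∫ x, f x ^ 2 ∂μ := integral_nonneg fun x => sq_nonneg _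
  have h1 : eLpNorm f 2 μ ^ 2 = ENNReal.ofReal √(∫ x, f x ^ 2 ∂μ) ^ 2 := by
    rw [eLpNorm_two_sq, ← ENNReal.ofReal_pow (Real.sqrt_nonneg _), Real.sq_sqrt h0,
      ofReal_integral_eq_lintegral_ofReal hf.integrable_sq (ae_of_all _ fun x => sq_nonneg _)]
    refine lintegral_congr fun x => ?_
    rw [← ofReal_norm, ← ENNReal.ofReal_pow (norm_nonneg _), Real.norm_eq_abs, sq_abs]
  exact (ENNReal.pow_right_strictMono two_ne_zero).injective h1

/-- Minkowski's inequality in `L²`. -/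
lemma sqrt_integral_add_sq_le {f g : X → ℝ} (hf : MemLp f 2 μ) (hg : MemLp g 2 μ) :
    √(∫ x, (f x + g x) ^ 2 ∂μ) ≤ √(∫ x, f x ^ 2 ∂μ) + √(∫ x, g x ^ 2 ∂μ) := by
  have h := eLpNorm_add_le hf.1 hg.1 one_le_two
  rw [eLpNorm_two_eq_ofReal_sqrt hf, eLpNorm_two_eq_ofReal_sqrt hg,
    eLpNorm_two_eq_ofReal_sqrt (hf.add hg),
    ← ENNReal.ofReal_add (Real.sqrt_nonneg _) (Real.sqrt_nonneg _)] at h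
  exact (ENNReal.ofReal_le_ofReal_iff (by positivity)).1 h

/-- Pythagoras: the excess of the squared error over that of the conditional expectation. -/
lemma integral_sub_sq_eq_condExp [IsProbabilityMeasure μ] {m : MeasurableSpace X} (hm : m ≤ mX)
    {f g : X → ℝ} (hf : MemLp f 2 μ) (hg : MemLp g 2 μ) (hgm : StronglyMeasurable[m] g) :
    ∫ x, (f x - g x) ^ 2 ∂μ
      = ∫ x, (f x - (μ[f | m]) x) ^ 2 ∂μ + ∫ x, ((μ[f | m]) x - g x) ^ 2 ∂μ := by
  have hE : MemLp (μ[f | m]) 2 μ := hf.condExp one_le_two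
  have hr : MemLp (μ[f | m] - g) 2 μ := hE.sub hg
  have hrm : StronglyMeasurable[m] (μ[f | m] - g) := stronglyMeasurable_condExp.sub hgm
  have i1 : Integrable (fun x => (f x - (μ[f | m]) x) ^ 2) μ := (hf.sub hE).integrable_sq
  have i2 : Integrable (fun x => ((μ[f | m]) x - g x) ^ 2) μ := hr.integrable_sq
  have j1 : Integrable ((μ[f | m] - g) * f) μ := hr.integrable_mul hf
  have j2 : Integrable ((μ[f | m] - g) * μ[f | m]) μ := hr.integrable_mul hE
  -- The factor E[f | m] - g is m-measurable, so f may be replaced by E[f | m] next to it; this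
  -- kills the cross term.
  have hcross : ∫ x, ((μ[f | m] - g) * f) x ∂μ = ∫ x, ((μ[f | m] - g) * μ[f | m]) x ∂μ := by
    rw [← integral_condExp hm]
    exact integral_congr_ae
      (condExp_mul_of_stronglyMeasurable_left hrm j1 (hf.integrable one_le_two))
  have i3 : Integrable (fun x => 2 * (((μ[f | m] - g) * f) x - ((μ[f | m] - g) * μ[f | m]) x)) μ :=
    (j1.sub j2).const_mul 2
  have i4 : Integrable (fun x => (f x - (μ[f | m]) x) ^ 2 + ((μ[f | m]) x - g x) ^ 2) μ :=
    i1.add i2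
  have hpt : ∀ x, (f x - g x) ^ 2 = ((f x - (μ[f | m]) x) ^ 2 + ((μ[f | m]) x - g x) ^ 2)
      + 2 * (((μ[f | m] - g) * f) x - ((μ[f | m] - g) * μ[f | m]) x) := by
    intro x
    simp only [Pi.mul_apply, Pi.sub_apply]
    ring
  simp_rw [hpt]
  rw [integral_add i4 i3, integral_add i1 i2, integral_const_mul, integral_sub j1 j2, hcross]
  simp

end L2

/-! ### Excess risks and oracle inequalities of the two stages -/

namespace Model

variable {Ω 𝒰 𝒜 𝒵 𝒲 ΘA1 ΘZ ΘA2 ΘW : Type*} [MeasurableSpace Ω] [MeasurableSpace 𝒰]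
    [MeasurableSpace 𝒜] [MeasurableSpace 𝒵] [MeasurableSpace 𝒲] {pA pZ qA d : ℕ}
    (F : Model 𝒜 𝒵 𝒲 ΘA1 ΘZ ΘA2 ΘW pA pZ qA d) (P : Population Ω 𝒰 𝒜 𝒵 𝒲)

/-- The regression of the outcome features on `(A, Z)`. -/
noncomputable def regress (θ : ΘW) (ω : Ω) (i : Fin d) : ℝ :=
  P.condAZ (fun ω' => F.ψW θ (P.W ω') i) ω

/-- The excess risk of stage 1. -/
noncomputable def excess1 (θ : ΘW) (q : Param1 ΘA1 ΘZ pA pZ d) : ℝ :=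
  ∫ ω, sqNorm (fun i => F.regress P θ ω i - F.pred1 q (P.A ω) (P.Z ω) i) ∂P.μ

variable {F P} {M : ℝ}

lemma _root_.DFPV.Population.stronglyMeasurable_comap_AZ {f : 𝒜 × 𝒵 → ℝ} (hf : Measurable f) :
    StronglyMeasurable[MeasurableSpace.comap (fun ω => (P.A ω, P.Z ω)) inferInstance]
      fun ω => f (P.A ω, P.Z ω) :=
  (hf.comp (comap_measurable fun ω => (P.A ω, P.Z ω))).stronglyMeasurable

lemma _root_.DFPV.Population.comap_AZ_le :
    MeasurableSpace.comap (fun ω => (P.A ω, P.Z ω)) inferInstance ≤ ‹MeasurableSpace Ω› :=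
  (P.measA.prodMk P.measZ).comap_le

namespace BoundedBy

lemma memLp_outcome (h : F.BoundedBy P M) : MemLp P.Y 2 P.μ :=
  MemLp.of_bound P.measY.aestronglyMeasurable M h.outcome

lemma memLp_feature (h : F.BoundedBy P M) {p} (hp : p ∈ F.adm2) (i : Fin d) :
    MemLp (fun ω => F.ψW p.θW (P.W ω) i) 2 P.μ :=
  memLp_of_abs_le ((F.measurable_ψW p.θW i).comp P.measW) (B := M) fun ω =>
    abs_le_of_sq_le_sq ((sq_apply_le_sqNorm _ i).trans (h.sqNorm_ψW hp (P.W ω))) h.nonneg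

lemma memLp_pred1 (h : F.BoundedBy P M) {q} (hq : q ∈ F.adm1) (i : Fin d) :
    MemLp (fun ω => F.pred1 q (P.A ω) (P.Z ω) i) 2 P.μ :=
  memLp_of_abs_le ((F.measurable_pred1 q i).comp (P.measA.prodMk P.measZ)) (B := M) fun _ =>
    abs_le_of_sq_le_sq ((sq_apply_le_sqNorm _ i).trans (h.sqNorm_pred1 hq _ _)) h.nonneg

lemma memLp_regress (h : F.BoundedBy P M) {p} (hp : p ∈ F.adm2) (i : Fin d) :
    MemLp (fun ω => F.regress P p.θW ω i) 2 P.μ :=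
  (h.memLp_feature hp i).condExp one_le_two

lemma memLp_bridge (h : F.BoundedBy P M) {p} (hp : p ∈ F.adm2) :
    MemLp (fun ω => F.bridge p (P.A ω) (P.W ω)) 2 P.μ :=
  memLp_of_abs_le ((F.measurable_bridge p).comp (P.measA.prodMk P.measW)) (B := M ^ 2)
    fun _ => h.abs_bridge_le hp _ _

lemma memLp_lin2_pred1 (h : F.BoundedBy P M) {p} (hp : p ∈ F.adm2) {q} (hq : q ∈ F.adm1) :
    MemLp (fun ω => F.lin2 p (P.A ω) (F.pred1 q (P.A ω) (P.Z ω))) 2 P.μ :=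
  memLp_of_abs_le (F.measurable_lin2 p P.measA fun j =>
    (F.measurable_pred1 q j).comp (P.measA.prodMk P.measZ)) (B := M ^ 2)
    fun _ => h.abs_lin2_pred1_le hp hq _ _

lemma integrable_excess1 (h : F.BoundedBy P M) {p} (hp : p ∈ F.adm2) {q} (hq : q ∈ F.adm1) :
    Integrable (fun ω => sqNorm (fun i =>
      F.regress P p.θW ω i - F.pred1 q (P.A ω) (P.Z ω) i)) P.μ :=
  integrable_finsetSum _ fun i _ => ((h.memLp_regress hp i).sub (h.memLp_pred1 hq i)).integrable_sq

/-- The population risk of stage 1 is the excess risk up to a term that does not depend on the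
stage 1 parameters. -/
lemma integral_loss1 (h : F.BoundedBy P M) {p} (hp : p ∈ F.adm2) {q} (hq : q ∈ F.adm1) :
    ∫ x, F.loss1 p.θW q x ∂P.lawWAZ
      = ∑ i, ∫ ω, (F.ψW p.θW (P.W ω) i - F.regress P p.θW ω i) ^ 2 ∂P.μ
        + F.excess1 P p.θW q := by
  have hm : Measurable fun ω => (P.W ω, P.A ω, P.Z ω) := P.measW.prodMk (P.measA.prodMk P.measZ)
  rw [Population.lawWAZ, integral_map hm.aemeasurable (F.measurable_loss1 _ _).aestronglyMeasurable]
  simp only [loss1, sqNorm, excess1, Pi.sub_apply]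
  have i₁ : ∀ i ∈ Finset.univ, Integrable (fun ω =>
      (F.ψW p.θW (P.W ω) i - F.pred1 q (P.A ω) (P.Z ω) i) ^ 2) P.μ :=
    fun i _ => ((h.memLp_feature hp i).sub (h.memLp_pred1 hq i)).integrable_sq
  have i₂ : ∀ i ∈ Finset.univ, Integrable (fun ω =>
      (F.regress P p.θW ω i - F.pred1 q (P.A ω) (P.Z ω) i) ^ 2) P.μ :=
    fun i _ => ((h.memLp_regress hp i).sub (h.memLp_pred1 hq i)).integrable_sq
  rw [integral_finsetSum _ i₁, integral_finsetSum _ i₂, ← Finset.sum_add_distrib]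
  exact Finset.sum_congr rfl fun i _ => integral_sub_sq_eq_condExp Population.comap_AZ_le
    (h.memLp_feature hp i) (h.memLp_pred1 hq i)
    (Population.stronglyMeasurable_comap_AZ (f := fun x => F.pred1 q x.1 x.2 i)
      (F.measurable_pred1 q i))

lemma excess1_nonneg (θ : ΘW) (q : Param1 ΘA1 ΘZ pA pZ d) : 0 ≤ F.excess1 P θ q :=
  integral_nonneg fun _ => sqNorm_nonneg _

/-- Excess risk is at most total risk, since the irreducible part is nonnegative. The uniform bound
makes the supremum defining κ₁ a true supremum rather than the default value 0. -/
lemma excess1_le (h : F.BoundedBy P M) {p} (hp : p ∈ F.adm2) {q} (hq : q ∈ F.adm1) :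
    F.excess1 P p.θW q ≤ 4 * M ^ 2 := by
  have h1 := h.integral_loss1 hp hq
  have h2 : ∫ x, F.loss1 p.θW q x ∂P.lawWAZ ≤ 4 * M ^ 2 :=
    (le_abs_self _).trans (abs_integral_le_of_abs_le (h.abs_loss1_le ⟨p, hp, q, hq, rfl⟩))
  have h3 : 0 ≤ ∑ i, ∫ ω, (F.ψW p.θW (P.W ω) i - F.regress P p.θW ω i) ^ 2 ∂P.μ :=
    Finset.sum_nonneg fun i _ => integral_nonneg fun _ => sq_nonneg _
  linarith

lemma iInf_excess1_le_kappa1 (h : F.BoundedBy P M) {p} (hp : p ∈ F.adm2)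
    (hne : F.adm1.Nonempty) : ⨅ q : F.adm1, F.excess1 P p.θW q.1 ≤ F.kappa1 P := by
  obtain ⟨q₀, hq₀⟩ := hne
  have hbb : ∀ p : F.adm2, BddBelow (Set.range fun q : F.adm1 => F.excess1 P p.1.θW q.1) :=
    fun p => ⟨0, by rintro _ ⟨q, rfl⟩; exact excess1_nonneg _ _⟩
  refine le_ciSup (f := fun p : F.adm2 => ⨅ q : F.adm1, F.excess1 P p.1.θW q.1)
    ⟨4 * M ^ 2, ?_⟩ ⟨p, hp⟩
  rintro _ ⟨p', rfl⟩
  exact (ciInf_le (hbb p') ⟨q₀, hq₀⟩).trans (h.excess1_le p'.2 hq₀)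

lemma kappa1_nonneg : 0 ≤ F.kappa1 P :=
  Real.iSup_nonneg fun _ => Real.iInf_nonneg fun _ => integral_nonneg fun _ => sqNorm_nonneg _

lemma kappa2_nonneg : 0 ≤ F.kappa2 P := Real.iInf_nonneg fun _ => Real.sqrt_nonneg _

/-- The oracle inequality of stage 1. -/
theorem excess1_stage1_le (h : F.BoundedBy P M) {m : ℕ} {lam c Δ : ℝ} (hlam : 0 ≤ lam)
    (hpen : ∀ q ∈ F.adm1, lam * sqNorm (fun ij : Fin d × (Fin pA × Fin pZ) => q.V ij.1 ij.2) ≤ c)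
    {s : Fin m → 𝒲 × 𝒜 × 𝒵} {q : ΘW → Param1 ΘA1 ΘZ pA pZ d}
    (hq : F.IsStage1Solution lam s q)
    (hdev : ∀ f ∈ F.class1, |∫ x, f x ∂P.lawWAZ - (m : ℝ)⁻¹ * ∑ i, f (s i)| ≤ Δ)
    {p} (hp : p ∈ F.adm2) : F.excess1 P p.θW (q p.θW) ≤ F.kappa1 P + c + 2 * Δ := by
  obtain ⟨hq₁, hmin⟩ := hq p hp
  have : Nonempty F.adm1 := ⟨⟨_, hq₁⟩⟩
  -- Compare with an arbitrary q', as the infimum need not be attained. The irreducible term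
  -- cancels, each of the two risks costs one Δ, the penalty of q' is at most c and that of the
  -- minimizer is dropped.
  have hle : F.excess1 P p.θW (q p.θW) - (c + 2 * Δ) ≤ ⨅ q : F.adm1, F.excess1 P p.θW q.1 := by
    refine le_ciInf fun q' => ?_
    have h1 := (abs_le.1 (hdev _ ⟨p, hp, _, hq₁, rfl⟩)).2
    have h2 := (abs_le.1 (hdev _ ⟨p, hp, q'.1, q'.2, rfl⟩)).1
    have h3 := hmin q'.1 q'.2
    have h4 := hpen q'.1 q'.2
    have h5 : 0 ≤ lam * sqNorm (fun ij : Fin d × (Fin pA × Fin pZ) => (q p.θW).V ij.1 ij.2) :=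
      mul_nonneg hlam (sqNorm_nonneg _)
    rw [h.integral_loss1 hp hq₁] at h1
    rw [h.integral_loss1 hp q'.2] at h2
    simp only [empLoss1] at h3
    linarith
  have := h.iInf_excess1_le_kappa1 hp ⟨_, hq₁⟩
  linarith

/-- The regression of the bridge model on `(A, Z)`. -/
lemma condAZ_bridge (h : F.BoundedBy P M) {p} (hp : p ∈ F.adm2) :
    P.condAZ (fun ω => F.bridge p (P.A ω) (P.W ω))
      =ᵐ[P.μ] fun ω => F.lin2 p (P.A ω) (F.regress P p.θW ω) := by
  -- The coefficients are bounded functions of A, hence come out of the conditional expectation.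
  have h1 : ∀ j, P.condAZ ((fun ω => F.lin2Coef p j (P.A ω)) * fun ω => F.ψW p.θW (P.W ω) j)
      =ᵐ[P.μ] (fun ω => F.lin2Coef p j (P.A ω)) * fun ω => F.regress P p.θW ω j := fun j =>
    condExp_stronglyMeasurable_mul_of_bound Population.comap_AZ_le
      (Population.stronglyMeasurable_comap_AZ (f := fun x => F.lin2Coef p j x.1)
        ((F.measurable_lin2Coef p j).comp measurable_fst))
      ((h.memLp_feature hp j).integrable one_le_two) M
      (ae_of_all _ fun _ => h.abs_lin2Coef_le hp j _)
  have hi : ∀ j, Integrable ((fun ω => F.lin2Coef p j (P.A ω)) *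
      fun ω => F.ψW p.θW (P.W ω) j) P.μ := fun j =>
    MemLp.integrable_mul (memLp_of_abs_le ((F.measurable_lin2Coef p j).comp P.measA)
      fun _ => h.abs_lin2Coef_le hp j _) (h.memLp_feature hp j)
  have h2 : (fun ω => F.bridge p (P.A ω) (P.W ω))
      = ∑ j, (fun ω => F.lin2Coef p j (P.A ω)) * fun ω => F.ψW p.θW (P.W ω) j := by
    ext ω
    simp [bridge, lin2_eq_sum]
  rw [h2]
  have h3 := condExp_finsetSum (s := Finset.univ) (fun j _ => hi j)
    (MeasurableSpace.comap (fun ω => (P.A ω, P.Z ω)) inferInstance)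
  filter_upwards [h3, ae_all_iff.2 h1] with ω w1 w2
  rw [Population.condAZ, w1, Finset.sum_apply, lin2_eq_sum]
  exact Finset.sum_congr rfl fun j _ => w2 j

lemma memLp_condAZ_bridge (h : F.BoundedBy P M) {p} (hp : p ∈ F.adm2) :
    MemLp (P.condAZ (fun ω => F.bridge p (P.A ω) (P.W ω))) 2 P.μ :=
  (h.memLp_bridge hp).condExp one_le_two

/-- Replacing the regression of the features by the stage 1 prediction. -/
lemma sqrt_integral_condAZ_bridge_sub_le (h : F.BoundedBy P M) {p} (hp : p ∈ F.adm2) {q}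
    (hq : q ∈ F.adm1) :
    √(∫ ω, (P.condAZ (fun ω => F.bridge p (P.A ω) (P.W ω)) ω
        - F.lin2 p (P.A ω) (F.pred1 q (P.A ω) (P.Z ω))) ^ 2 ∂P.μ)
      ≤ M * √(F.excess1 P p.θW q) := by
  rw [Real.sqrt_le_left (mul_nonneg h.nonneg (Real.sqrt_nonneg _)), mul_pow,
    Real.sq_sqrt (excess1_nonneg _ _), excess1, ← integral_const_mul]
  refine integral_mono_ae ((h.memLp_condAZ_bridge hp).sub (h.memLp_lin2_pred1 hp hq)).integrable_sq
    ((h.integrable_excess1 hp hq).const_mul _) ?_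
  filter_upwards [h.condAZ_bridge hp] with ω hω
  simp only [hω]
  rw [← lin2_sub]
  exact h.sq_lin2_le hp _ _

/-- The excess risk of stage 2. -/
noncomputable def _root_.DFPV.Model.excess2 (F : Model 𝒜 𝒵 𝒲 ΘA1 ΘZ ΘA2 ΘW pA pZ qA d)
    (P : Population Ω 𝒰 𝒜 𝒵 𝒲) (p : Param2 ΘA2 ΘW qA d) (q : Param1 ΘA1 ΘZ pA pZ d) : ℝ :=
  ∫ ω, (P.condAZ P.Y ω - F.lin2 p (P.A ω) (F.pred1 q (P.A ω) (P.Z ω))) ^ 2 ∂P.μ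

lemma integral_loss2 (h : F.BoundedBy P M) {p} (hp : p ∈ F.adm2) {q} (hq : q ∈ F.adm1) :
    ∫ x, F.loss2 p q x ∂P.lawYAZ
      = ∫ ω, (P.Y ω - P.condAZ P.Y ω) ^ 2 ∂P.μ + F.excess2 P p q := by
  have hm : Measurable fun ω => (P.Y ω, P.A ω, P.Z ω) := P.measY.prodMk (P.measA.prodMk P.measZ)
  rw [Population.lawYAZ, integral_map hm.aemeasurable (F.measurable_loss2 _ _).aestronglyMeasurable]
  exact integral_sub_sq_eq_condExp Population.comap_AZ_le h.memLp_outcome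
    (h.memLp_lin2_pred1 hp hq) (Population.stronglyMeasurable_comap_AZ
      (f := fun x => F.lin2 p x.1 (F.pred1 q x.1 x.2))
      (F.measurable_lin2 p measurable_fst fun j => F.measurable_pred1 q j))

/-- The oracle inequality of stage 2. -/
theorem sqrt_integral_condAZ_sub_le (h : F.BoundedBy P M) {m n : ℕ} {lam₁ lam₂ c₁ c₂ Δ₁ Δ₂ : ℝ}
    (hlam₁ : 0 ≤ lam₁) (hlam₂ : 0 ≤ lam₂)
    (hpen₁ : ∀ q ∈ F.adm1,
      lam₁ * sqNorm (fun ij : Fin d × (Fin pA × Fin pZ) => q.V ij.1 ij.2) ≤ c₁)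
    (hpen₂ : ∀ p ∈ F.adm2, lam₂ * sqNorm p.u ≤ c₂)
    {s₁ : Fin m → 𝒲 × 𝒜 × 𝒵} {s₂ : Fin n → ℝ × 𝒜 × 𝒵} {q : ΘW → Param1 ΘA1 ΘZ pA pZ d}
    {p : Param2 ΘA2 ΘW qA d}
    (hq : F.IsStage1Solution lam₁ s₁ q) (hp : F.IsStage2Solution lam₂ s₂ q p)
    (hdev₁ : ∀ f ∈ F.class1, |∫ x, f x ∂P.lawWAZ - (m : ℝ)⁻¹ * ∑ i, f (s₁ i)| ≤ Δ₁)
    (hdev₂ : ∀ f ∈ F.class2, |∫ x, f x ∂P.lawYAZ - (n : ℝ)⁻¹ * ∑ i, f (s₂ i)| ≤ Δ₂) :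
    √(∫ ω, (P.condAZ P.Y ω - P.condAZ (fun ω' => F.bridge p (P.A ω') (P.W ω')) ω) ^ 2 ∂P.μ)
      ≤ 2 * M * √(F.kappa1 P + c₁ + 2 * Δ₁) + F.kappa2 P + √(c₂ + 2 * Δ₂) := by
  have hM := h.nonneg
  set K : Param2 ΘA2 ΘW qA d → Ω → ℝ := fun p =>
    P.condAZ (fun ω' => F.bridge p (P.A ω') (P.W ω'))
  set G : Param2 ΘA2 ΘW qA d → Ω → ℝ := fun p ω =>
    F.lin2 p (P.A ω) (F.pred1 (q p.θW) (P.A ω) (P.Z ω))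
  have hE : MemLp (P.condAZ P.Y) 2 P.μ := h.memLp_outcome.condExp one_le_two
  have hK : ∀ p ∈ F.adm2, MemLp (K p) 2 P.μ := fun p hp => h.memLp_condAZ_bridge hp
  have hG : ∀ p ∈ F.adm2, MemLp (G p) 2 P.μ := fun p hp => h.memLp_lin2_pred1 hp (hq p hp).1
  set s := √(F.kappa1 P + c₁ + 2 * Δ₁)
  -- This holds for every admissible p at once because stage 1 is controlled uniformly in θ_W; the
  -- comparison parameter uses its own stage 1 solution and needs it as well.
  have hKG : ∀ p ∈ F.adm2, √(∫ ω, (K p ω - G p ω) ^ 2 ∂P.μ) ≤ M * s := fun p hp =>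
    (h.sqrt_integral_condAZ_bridge_sub_le hp (hq p hp).1).trans
      (mul_le_mul_of_nonneg_left
        (Real.sqrt_le_sqrt (h.excess1_stage1_le hlam₁ hpen₁ hq hdev₁ hp)) hM)
  -- The true regression K is exchanged for the plug-in G twice, once at the estimate and once at
  -- the comparison parameter, whence 2 M s.
  have key : ∀ p' : F.adm2, √(∫ ω, (P.condAZ P.Y ω - K p ω) ^ 2 ∂P.μ)
      - (2 * M * s + √(c₂ + 2 * Δ₂)) ≤ √(∫ ω, (P.condAZ P.Y ω - K p'.1 ω) ^ 2 ∂P.μ) := by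
    rintro ⟨p', hp'⟩
    have hex : F.excess2 P p (q p.θW) ≤ F.excess2 P p' (q p'.θW) + (c₂ + 2 * Δ₂) := by
      have h1 := (abs_le.1 (hdev₂ _ ⟨p, hp.1, _, (hq p hp.1).1, rfl⟩)).2
      have h2 := (abs_le.1 (hdev₂ _ ⟨p', hp', _, (hq p' hp').1, rfl⟩)).1
      have h3 := hp.2 p' hp'
      have h4 := hpen₂ p' hp'
      have h5 : 0 ≤ lam₂ * sqNorm p.u := mul_nonneg hlam₂ (sqNorm_nonneg _)
      rw [h.integral_loss2 hp.1 (hq p hp.1).1] at h1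
      rw [h.integral_loss2 hp' (hq p' hp').1] at h2
      simp only [empLoss2] at h3
      linarith
    have e1 : √(F.excess2 P p (q p.θW)) ≤ √(F.excess2 P p' (q p'.θW)) + √(c₂ + 2 * Δ₂) :=
      (Real.sqrt_le_sqrt hex).trans (sqrt_add_le_sqrt_add_sqrt _ _)
    have e2 : √(∫ ω, (P.condAZ P.Y ω - K p ω) ^ 2 ∂P.μ)
        ≤ √(F.excess2 P p (q p.θW)) + √(∫ ω, (K p ω - G p ω) ^ 2 ∂P.μ) := by
      have := sqrt_integral_add_sq_le (hE.sub (hG p hp.1)) ((hG p hp.1).sub (hK p hp.1))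
      simp only [Pi.sub_apply, sub_add_sub_cancel] at this
      simpa only [sub_sq_comm (K p _), excess2] using this
    have e3 : √(F.excess2 P p' (q p'.θW)) ≤ √(∫ ω, (P.condAZ P.Y ω - K p' ω) ^ 2 ∂P.μ)
        + √(∫ ω, (K p' ω - G p' ω) ^ 2 ∂P.μ) := by
      have := sqrt_integral_add_sq_le (hE.sub (hK p' hp')) ((hK p' hp').sub (hG p' hp'))
      simp only [Pi.sub_apply, sub_add_sub_cancel] at this
      exact this
    have e4 := hKG p hp.1
    have e5 := hKG p' hp'
    linarith
  have : Nonempty F.adm2 := ⟨⟨p, hp.1⟩⟩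
  have := le_ciInf key
  have hk : ⨅ p' : F.adm2, √(∫ ω, (P.condAZ P.Y ω - K p'.1 ω) ^ 2 ∂P.μ) = F.kappa2 P := rfl
  linarith

end BoundedBy

end Model

/-! ### Error decomposition: averaging over W, the extra sample, ill-posedness -/

/-- Under the support condition, averaging over the marginal law of `W` is bounded in `L²`. -/
lemma Population.GoodSupport.eLpNorm_integral_le {Ω 𝒰 𝒜 𝒵 𝒲 : Type*} [MeasurableSpace Ω]
    [MeasurableSpace 𝒰] [MeasurableSpace 𝒜] [MeasurableSpace 𝒵] [MeasurableSpace 𝒲]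
    {P : Population Ω 𝒰 𝒜 𝒵 𝒲} {η : ℝ} (hη : P.GoodSupport η) {f : 𝒜 × 𝒲 → ℝ}
    (hf : Measurable f) :
    eLpNorm (fun a => ∫ w, f (a, w) ∂P.lawW) 2 P.lawA
      ≤ ENNReal.ofReal √η * eLpNorm (fun ω => f (P.A ω, P.W ω)) 2 P.μ := by
  rw [← ENNReal.pow_le_pow_left_iff two_ne_zero, mul_pow, eLpNorm_two_sq, eLpNorm_two_sq,
    ← ENNReal.ofReal_pow (Real.sqrt_nonneg _)]
  have hη' : ENNReal.ofReal η ≤ ENNReal.ofReal (√η ^ 2) := by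
    refine ENNReal.ofReal_le_ofReal ?_
    rcases le_total 0 η with h | h
    · rw [Real.sq_sqrt h]
    · exact h.trans (sq_nonneg _)
  have hsq : Measurable fun x => ‖f x‖ₑ ^ 2 := hf.enorm.pow_const 2
  calc ∫⁻ a, ‖∫ w, f (a, w) ∂P.lawW‖ₑ ^ 2 ∂P.lawA
      ≤ ∫⁻ a, ∫⁻ w, ‖f (a, w)‖ₑ ^ 2 ∂P.lawW ∂P.lawA :=
        lintegral_mono fun a =>
          enorm_integral_sq_le (hf.comp measurable_prodMk_left).aestronglyMeasurable
    _ = ∫⁻ x, ‖f x‖ₑ ^ 2 ∂(P.lawA.prod P.lawW) := (lintegral_prod _ hsq.aemeasurable).symm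
    _ ≤ ENNReal.ofReal η * ∫⁻ ω, ‖f (P.A ω, P.W ω)‖ₑ ^ 2 ∂P.μ := hη.lintegral_le hsq
    _ ≤ _ := by gcongr

namespace Model

variable {Ω 𝒰 𝒜 𝒵 𝒲 ΘA1 ΘZ ΘA2 ΘW : Type*} [MeasurableSpace Ω] [MeasurableSpace 𝒰]
    [MeasurableSpace 𝒜] [MeasurableSpace 𝒵] [MeasurableSpace 𝒲] {pA pZ qA d : ℕ}
    {F : Model 𝒜 𝒵 𝒲 ΘA1 ΘZ ΘA2 ΘW pA pZ qA d} {P : Population Ω 𝒰 𝒜 𝒵 𝒲} {M : ℝ}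

namespace BoundedBy

/-- The mean squared error of the empirical mean over the extra sample. -/
lemma lintegral_integral_bridge_sub_fHat_le (h : F.BoundedBy P M) {k : ℕ} (hk : 0 < k) {p}
    (hp : p ∈ F.adm2) (a : 𝒜) :
    ∫⁻ w, ‖∫ w', F.bridge p a w' ∂P.lawW - F.fHat p w a‖ₑ ^ 2 ∂(Measure.pi fun _ : Fin k => P.lawW)
      ≤ ENNReal.ofReal (4 * M ^ 4 / k) := by
  have hk' : (0 : ℝ) < k := by exact_mod_cast hk
  have hb : Measurable (F.bridge p a) := (F.measurable_bridge p).comp measurable_prodMk_left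
  have hB : ∀ w, |F.bridge p a w| ≤ M ^ 2 := h.abs_bridge_le hp a
  set f : (Fin k → 𝒲) → ℝ := fun w => F.fHat p w a
  have hf : Measurable f := by
    simp only [f, fHat_eq]
    fun_prop
  have hfB : ∀ w, |f w| ≤ M ^ 2 := fun w => by
    simp only [f, fHat_eq]
    exact abs_inv_mul_sum_le (sq_nonneg M) fun i => hB _
  -- The differences 2M²/k give the variance bound k (2M²/k)² = 4M⁴/k.
  have hfc : ∀ w i y, |f (Function.update w i y) - f w| ≤ 2 * M ^ 2 / k := fun w i y => by
    have := abs_inv_mul_sum_update_sub_le (fun _ => true) hB w i y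
    simpa only [f, fHat_eq, if_true, one_mul] using this
  have hmean : ∫ w, f w ∂(Measure.pi fun _ : Fin k => P.lawW) = ∫ w', F.bridge p a w' ∂P.lawW := by
    simp only [f, fHat_eq]
    have hi : ∀ i ∈ Finset.univ, Integrable (fun w : Fin k → 𝒲 => F.bridge p a (w i))
        (Measure.pi fun _ : Fin k => P.lawW) := fun i _ =>
      integrable_of_abs_le (hb.comp (measurable_pi_apply i)) fun w => hB _
    rw [integral_const_mul, integral_finsetSum _ hi]
    have : ∀ i, ∫ w : Fin k → 𝒲, F.bridge p a (w i) ∂(Measure.pi fun _ : Fin k => P.lawW)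
        = ∫ w', F.bridge p a w' ∂P.lawW := fun i =>
      integral_comp_measurePreserving (measurePreserving_eval (fun _ => P.lawW) i) hb
    simp only [this, Finset.sum_const, Finset.card_univ, Fintype.card_fin, nsmul_eq_mul]
    field_simp
  have hvar := integral_sub_mean_sq_pi_le (ν := P.lawW) _ k f hf _ hfB hfc
  rw [hmean] at hvar
  have hint : Integrable (fun w => (f w - ∫ w', F.bridge p a w' ∂P.lawW) ^ 2)
      (Measure.pi fun _ : Fin k => P.lawW) :=
    ((memLp_of_abs_le hf hfB).sub (memLp_const _)).integrable_sq
  calc ∫⁻ w, ‖∫ w', F.bridge p a w' ∂P.lawW - f w‖ₑ ^ 2 ∂(Measure.pi fun _ : Fin k => P.lawW)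
      = ∫⁻ w, ENNReal.ofReal ((f w - ∫ w', F.bridge p a w' ∂P.lawW) ^ 2)
          ∂(Measure.pi fun _ : Fin k => P.lawW) := by
        refine lintegral_congr fun w => ?_
        rw [← ofReal_norm, ← ENNReal.ofReal_pow (norm_nonneg _), Real.norm_eq_abs, sq_abs,
          sub_sq_comm]
    _ = ENNReal.ofReal (∫ w, (f w - ∫ w', F.bridge p a w' ∂P.lawW) ^ 2
          ∂(Measure.pi fun _ : Fin k => P.lawW)) :=
        (ofReal_integral_eq_lintegral_ofReal hint (ae_of_all _ fun w => sq_nonneg _)).symm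
    _ ≤ _ := by
        refine ENNReal.ofReal_le_ofReal (hvar.trans (le_of_eq ?_))
        field_simp
        ring

/-- The deviation of the empirical mean over the extra sample, for a bridge function estimated
from independent data. -/
theorem measure_integral_bridge_sub_fHat_gt_le (h : F.BoundedBy P M) {k : ℕ} (hk : 0 < k)
    {X : Type*} [MeasurableSpace X] (Q : Measure X) [IsProbabilityMeasure Q]
    {p : X → Param2 ΘA2 ΘW qA d} (hp : ∀ᵐ x ∂Q, p x ∈ F.adm2)
    (hm : Measurable fun x : X × (𝒜 × 𝒲) => F.bridge (p x.1) x.2.1 x.2.2) {t : ℝ} (ht : 0 < t) :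
    (Q.prod (Measure.pi fun _ : Fin k => P.lawW)) {x | ENNReal.ofReal (t / √k) <
        eLpNorm (fun a => ∫ w, F.bridge (p x.1) a w ∂P.lawW - F.fHat (p x.1) x.2 a) 2 P.lawA}
      ≤ ENNReal.ofReal (4 * M ^ 4 / t ^ 2) := by
  have hk' : (0 : ℝ) < k := by exact_mod_cast hk
  set ρ : Measure (Fin k → 𝒲) := Measure.pi fun _ => P.lawW
  set G : (X × (Fin k → 𝒲)) × 𝒜 → ℝ := fun y =>
    ∫ w, F.bridge (p y.1.1) y.2 w ∂P.lawW - F.fHat (p y.1.1) y.1.2 y.2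
  have hG : Measurable G := by
    refine Measurable.sub ?_ ?_
    · have : StronglyMeasurable (Function.uncurry fun (y : (X × (Fin k → 𝒲)) × 𝒜) (w : 𝒲) =>
          F.bridge (p y.1.1) y.2 w) :=
        (hm.comp (f := fun y : ((X × (Fin k → 𝒲)) × 𝒜) × 𝒲 => (y.1.1.1, (y.1.2, y.2)))
          (by fun_prop)).stronglyMeasurable
      exact this.integral_prod_right.measurable
    · simp only [fHat_eq]
      refine Measurable.const_mul (Finset.measurable_sum _ fun i _ => ?_) _
      exact hm.comp (f := fun y : (X × (Fin k → 𝒲)) × 𝒜 => (y.1.1, (y.2, y.1.2 i))) (by fun_prop)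
  have hG2 : Measurable fun y => ‖G y‖ₑ ^ 2 := hG.enorm.pow_const 2
  have hN : Measurable fun x => ∫⁻ a, ‖G (x, a)‖ₑ ^ 2 ∂P.lawA := hG2.lintegral_prod_right'
  have hbound : ∫⁻ x, ∫⁻ a, ‖G (x, a)‖ₑ ^ 2 ∂P.lawA ∂(Q.prod ρ)
      ≤ ENNReal.ofReal (4 * M ^ 4 / k) := by
    rw [lintegral_prod _ hN.aemeasurable]
    calc ∫⁻ x, ∫⁻ w, ∫⁻ a, ‖G ((x, w), a)‖ₑ ^ 2 ∂P.lawA ∂ρ ∂Q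
        ≤ ∫⁻ _x, ENNReal.ofReal (4 * M ^ 4 / k) ∂Q := by
          refine lintegral_mono_ae ?_
          filter_upwards [hp] with x hx
          have hx2 : Measurable (Function.uncurry fun (w : Fin k → 𝒲) (a : 𝒜) =>
              ‖G ((x, w), a)‖ₑ ^ 2) :=
            hG2.comp (f := fun y : (Fin k → 𝒲) × 𝒜 => ((x, y.1), y.2)) (by fun_prop)
          -- With the first two samples fixed, the bridge function is fixed, so the pointwise
          -- variance bound can be averaged over a. Markov's inequality for the squared norm then
          -- concludes.
          rw [lintegral_lintegral_swap hx2.aemeasurable]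
          calc ∫⁻ a, ∫⁻ w, ‖G ((x, w), a)‖ₑ ^ 2 ∂ρ ∂P.lawA
              ≤ ∫⁻ _a, ENNReal.ofReal (4 * M ^ 4 / k) ∂P.lawA :=
                lintegral_mono fun a => h.lintegral_integral_bridge_sub_fHat_le hk hx a
            _ = ENNReal.ofReal (4 * M ^ 4 / k) := by simp
      _ = ENNReal.ofReal (4 * M ^ 4 / k) := by simp
  have ht2 : (0 : ℝ) < t ^ 2 / k := by positivity
  calc (Q.prod ρ) {x | ENNReal.ofReal (t / √k) < eLpNorm (fun a => G (x, a)) 2 P.lawA}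
      ≤ (Q.prod ρ) {x | ENNReal.ofReal (t ^ 2 / k) ≤ ∫⁻ a, ‖G (x, a)‖ₑ ^ 2 ∂P.lawA} := by
        refine measure_mono fun x hx => ?_
        have hx' : ENNReal.ofReal (t / √k) < eLpNorm (fun a => G (x, a)) 2 P.lawA := hx
        have := pow_le_pow_left' hx'.le 2
        rwa [eLpNorm_two_sq, ← ENNReal.ofReal_pow (by positivity), div_pow,
          Real.sq_sqrt hk'.le] at this
    _ ≤ (∫⁻ x, ∫⁻ a, ‖G (x, a)‖ₑ ^ 2 ∂P.lawA ∂(Q.prod ρ)) / ENNReal.ofReal (t ^ 2 / k) :=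
        meas_ge_le_lintegral_div hN.aemeasurable (by simpa using ht2) ENNReal.ofReal_ne_top
    _ ≤ ENNReal.ofReal (4 * M ^ 4 / k) / ENNReal.ofReal (t ^ 2 / k) := by gcongr
    _ = ENNReal.ofReal (4 * M ^ 4 / t ^ 2) := by
        rw [← ENNReal.ofReal_div_of_pos ht2]
        congr 1
        field_simp

/-- The error of a bridge function of the model in terms of the residual of the bridge equation. -/
lemma eLpNorm_bridge_sub_le (h : F.BoundedBy P M) {hstar : 𝒜 → 𝒲 → ℝ} (hb : P.IsBridge hstar)
    (hτ : F.illPosedness P hstar ≠ ∞) {p} (hp : p ∈ F.adm2) :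
    eLpNorm (fun ω => F.bridge p (P.A ω) (P.W ω) - hstar (P.A ω) (P.W ω)) 2 P.μ
      ≤ F.illPosedness P hstar * ENNReal.ofReal √(∫ ω, (P.condAZ P.Y ω
          - P.condAZ (fun ω' => F.bridge p (P.A ω') (P.W ω')) ω) ^ 2 ∂P.μ) := by
  have hY : MemLp (P.condAZ P.Y) 2 P.μ := h.memLp_outcome.condExp one_le_two
  have hae : P.condAZ (fun ω => F.bridge p (P.A ω) (P.W ω) - hstar (P.A ω) (P.W ω))
      =ᵐ[P.μ] P.condAZ (fun ω => F.bridge p (P.A ω) (P.W ω)) - P.condAZ P.Y := by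
    have h1 : P.condAZ (fun ω => F.bridge p (P.A ω) (P.W ω) - hstar (P.A ω) (P.W ω))
        =ᵐ[P.μ] P.condAZ (fun ω => F.bridge p (P.A ω) (P.W ω))
          - P.condAZ (fun ω => hstar (P.A ω) (P.W ω)) :=
      condExp_sub ((h.memLp_bridge hp).integrable one_le_two) (hb.memLp.integrable one_le_two) _
    filter_upwards [h1, hb.bridge] with ω w1 w2
    rw [w1, Pi.sub_apply, Pi.sub_apply, w2]
  have hnorm : eLpNorm (P.condAZ (fun ω =>
      F.bridge p (P.A ω) (P.W ω) - hstar (P.A ω) (P.W ω))) 2 P.μ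
      = ENNReal.ofReal √(∫ ω, (P.condAZ P.Y ω
          - P.condAZ (fun ω' => F.bridge p (P.A ω') (P.W ω')) ω) ^ 2 ∂P.μ) := by
    rw [eLpNorm_congr_ae hae, eLpNorm_two_eq_ofReal_sqrt ((h.memLp_condAZ_bridge hp).sub hY)]
    congr 3 with ω
    exact sub_sq_comm _ _
  -- Finiteness of τ excludes the one bad case: for a zero denominator and τ = ∞ the product on the
  -- right would be ∞ · 0 = 0.
  rw [← hnorm, ← ENNReal.div_le_iff_le_mul (Or.inr hτ)
    (Or.inl (by rw [hnorm]; exact ENNReal.ofReal_ne_top))]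
  exact le_iSup₂ (f := fun p (_ : p ∈ F.adm2) =>
    eLpNorm (fun ω => F.bridge p (P.A ω) (P.W ω) - hstar (P.A ω) (P.W ω)) 2 P.μ /
      eLpNorm (P.condAZ (fun ω => F.bridge p (P.A ω) (P.W ω) - hstar (P.A ω) (P.W ω))) 2 P.μ) p hp

/-- The estimation error of the structural function splits into the error of the bridge function
and that of the average over `W`. -/
theorem eLpNorm_fStruct_sub_le [StandardBorelSpace Ω] [StandardBorelSpace 𝒵]
    [StandardBorelSpace 𝒜] [StandardBorelSpace 𝒲] (h : F.BoundedBy P M) (hS : P.Structural)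
    (hU : P.CompleteFor P.U) {hstar : 𝒜 → 𝒲 → ℝ} (hb : P.IsBridge hstar) {η : ℝ}
    (hη : P.GoodSupport η) {p} (hp : p ∈ F.adm2) {k : ℕ} (w : Fin k → 𝒲) :
    eLpNorm (fun a => P.fStruct a - F.fHat p w a) 2 P.lawA
      ≤ ENNReal.ofReal √η *
          eLpNorm (fun ω => F.bridge p (P.A ω) (P.W ω) - hstar (P.A ω) (P.W ω)) 2 P.μ
        + eLpNorm (fun a => ∫ w, F.bridge p a w ∂P.lawW - F.fHat p w a) 2 P.lawA := by
  have hbr := F.measurable_bridge p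
  have hdiff : Measurable fun x : 𝒜 × 𝒲 => F.bridge p x.1 x.2 - hstar x.1 x.2 :=
    hbr.sub hb.measurable
  set f : 𝒜 → ℝ := fun a => ∫ w, (F.bridge p a w - hstar a w) ∂P.lawW
  set g : 𝒜 → ℝ := fun a => ∫ w, F.bridge p a w ∂P.lawW - F.fHat p w a
  have hf : AEStronglyMeasurable f P.lawA :=
    hdiff.stronglyMeasurable.integral_prod_right'.aestronglyMeasurable
  have hg : AEStronglyMeasurable g P.lawA := by
    refine (hbr.stronglyMeasurable.integral_prod_right'.sub
      (Measurable.stronglyMeasurable ?_)).aestronglyMeasurable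
    rw [funext fun a => F.fHat_eq p w a]
    exact Measurable.const_mul (Finset.measurable_sum _ fun i _ =>
      hbr.comp (f := fun a => (a, w i)) (by fun_prop)) _
  have hae : (fun a => P.fStruct a - F.fHat p w a) =ᵐ[P.lawA] -f + g := by
    filter_upwards [P.fStruct_ae_eq hS hU hb h.outcome hη, hb.ae_integrable hη] with a ha hai
    have hi : Integrable (F.bridge p a) P.lawW :=
      integrable_of_abs_le (hbr.comp measurable_prodMk_left) (h.abs_bridge_le hp a)
    simp only [ha, Pi.add_apply, Pi.neg_apply, f, g]
    rw [integral_sub hi hai]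
    ring
  rw [eLpNorm_congr_ae hae]
  refine (eLpNorm_add_le hf.neg hg one_le_two).trans ?_
  rw [eLpNorm_neg]
  exact add_le_add_left (hη.eLpNorm_integral_le hdiff) _

end BoundedBy

end Model

/-! ### Constants and the final union bound -/

/-- The number 4 + |Λ| + 6t dominates every coefficient under both roots, so its root factors out.
Here a and b stand for 1/√m and 1/√n. -/
lemma risk_bound_le {M Λ t κ₁ κ₂ R₁ R₂ a b : ℝ} (hM : 0 ≤ M) (ht : 0 ≤ t) (hκ₁ : 0 ≤ κ₁)
    (hκ₂ : 0 ≤ κ₂) (hR₁ : 0 ≤ R₁) (hR₂ : 0 ≤ R₂) (ha : 0 ≤ a) (hb : 0 ≤ b) :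
    2 * M * √(κ₁ + Λ * a + 2 * (2 * R₁ + 3 * t * a)) + κ₂ + √(Λ * b + 2 * (2 * R₂ + 3 * t * b))
      ≤ ((2 * M + 1) * √(4 + |Λ| + 6 * t) + 1) * (√(κ₁ + R₁ + a) + κ₂ + √(R₂ + b)) := by
  set K := 4 + |Λ| + 6 * t
  have hΛ := abs_nonneg Λ
  have hK : 0 ≤ K := by positivity
  have e1 : √(κ₁ + Λ * a + 2 * (2 * R₁ + 3 * t * a)) ≤ √K * √(κ₁ + R₁ + a) := by
    rw [← Real.sqrt_mul hK]
    refine Real.sqrt_le_sqrt ?_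
    have h1 : Λ * a ≤ |Λ| * a := mul_le_mul_of_nonneg_right (le_abs_self Λ) ha
    have h2 : 0 ≤ (|Λ| + 6 * t) * (κ₁ + R₁) := by positivity
    simp only [K]
    nlinarith
  have e2 : √(Λ * b + 2 * (2 * R₂ + 3 * t * b)) ≤ √K * √(R₂ + b) := by
    rw [← Real.sqrt_mul hK]
    refine Real.sqrt_le_sqrt ?_
    have h1 : Λ * b ≤ |Λ| * b := mul_le_mul_of_nonneg_right (le_abs_self Λ) hb
    have h2 : 0 ≤ (|Λ| + 6 * t) * R₂ := by positivity
    simp only [K]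
    nlinarith
  have hs := Real.sqrt_nonneg K
  have h1 := Real.sqrt_nonneg (κ₁ + R₁ + a)
  have h2 := Real.sqrt_nonneg (R₂ + b)
  have e3 := mul_le_mul_of_nonneg_left e1 (show 0 ≤ 2 * M by positivity)
  have e4 : 0 ≤ √K * √(κ₁ + R₁ + a) := by positivity
  have e5 : 0 ≤ M * (√K * √(R₂ + b)) := by positivity
  have e6 : 0 ≤ (2 * M + 1) * √K * κ₂ := by positivity
  nlinarith

end DFPV

theorem proposition2
    {Ω 𝒰 𝒜 𝒵 𝒲 ΘA1 ΘZ ΘA2 ΘW : Type*}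
    [MeasurableSpace Ω] [StandardBorelSpace Ω] [MeasurableSpace 𝒰] [StandardBorelSpace 𝒰]
    [MeasurableSpace 𝒜] [StandardBorelSpace 𝒜] [MeasurableSpace 𝒵] [StandardBorelSpace 𝒵]
    [MeasurableSpace 𝒲] [StandardBorelSpace 𝒲]
    (M η Λ δ : ℝ) (hδ : 0 < δ) :
    -- the constant depends on the bounds `M`, `η`, `Λ` and on the confidence level `δ` only
    ∃ C : ℝ, 0 < C ∧
      ∀ (P : DFPV.Population Ω 𝒰 𝒜 𝒵 𝒲) (pA pZ qA d : ℕ)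
        (F : DFPV.Model 𝒜 𝒵 𝒲 ΘA1 ΘZ ΘA2 ΘW pA pZ qA d) (hstar : 𝒜 → 𝒲 → ℝ),
      P.Structural → P.CompleteFor P.U → P.CompleteFor P.W → P.IsBridge hstar →
      F.BoundedBy P M → P.GoodSupport η → F.PointwiseSeparable →
      ∀ (m n nW : ℕ), 0 < m → 0 < n → 0 < nW →
      -- ridge parameters whose penalties are at most of the order of the sampling error
      ∀ (lam1 lam2 : ℝ), 0 ≤ lam1 → 0 ≤ lam2 →
      (∀ q ∈ F.adm1, lam1 * DFPV.sqNorm (fun ij : Fin d × (Fin pA × Fin pZ) => q.V ij.1 ij.2)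
        ≤ Λ / Real.sqrt m) →
      (∀ p ∈ F.adm2, lam2 * DFPV.sqNorm p.u ≤ Λ / Real.sqrt n) →
      -- the joint law of the stage 1 and stage 2 samples: each sample is i.i.d.
      ∀ (Q : Measure ((Fin m → 𝒲 × 𝒜 × 𝒵) × (Fin n → ℝ × 𝒜 × 𝒵))),
      Q.map Prod.fst = Measure.pi (fun _ => P.lawWAZ) →
      Q.map Prod.snd = Measure.pi (fun _ => P.lawYAZ) →
      -- the minimizers of the two empirical losses, as functions of the samples
      ∀ (qHat : (Fin m → 𝒲 × 𝒜 × 𝒵) → ΘW → DFPV.Param1 ΘA1 ΘZ pA pZ d)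
        (pHat : (Fin m → 𝒲 × 𝒜 × 𝒵) × (Fin n → ℝ × 𝒜 × 𝒵) → DFPV.Param2 ΘA2 ΘW qA d),
      (∀ᵐ s ∂Q, F.IsStage1Solution lam1 s.1 (qHat s.1) ∧
        F.IsStage2Solution lam2 s.2 (qHat s.1) (pHat s)) →
      Measurable (fun x : ((Fin m → 𝒲 × 𝒜 × 𝒵) × (Fin n → ℝ × 𝒜 × 𝒵)) × (𝒜 × 𝒲) =>
        F.bridge (pHat x.1) x.2.1 x.2.2) →
      -- the extra sample of `W` is i.i.d. and independent of the other two
      (Q.prod (Measure.pi (fun _ : Fin nW => P.lawW)))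
        {x | ENNReal.ofReal C *
            (F.illPosedness P hstar * ENNReal.ofReal
                (Real.sqrt (F.kappa1 P + DFPV.empRademacher F.class1 x.1.1 + 1 / Real.sqrt m)
                  + F.kappa2 P
                  + Real.sqrt (DFPV.empRademacher F.class2 x.1.2 + 1 / Real.sqrt n))
              + ENNReal.ofReal (1 / Real.sqrt nW))
          < eLpNorm (fun a => P.fStruct a - F.fHat (pHat x.1) x.2 a) 2 P.lawA}
        ≤ ENNReal.ofReal δ := by
  set B₁ : ℝ := 4 * M ^ 2 with hB₁
  set B₂ : ℝ := (M + M ^ 2) ^ 2 with hB₂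
  set S : ℝ := 16 * B₁ ^ 2 + 16 * B₂ ^ 2 + 4 * M ^ 4 with hS
  have hS0 : 0 ≤ S := by positivity
  -- The three failure probabilities add up to S / t², which this choice makes at most δ; the + 1
  -- keeps t positive when S = 0.
  set t : ℝ := √((S + 1) / δ) with ht_def
  have ht : 0 < t := Real.sqrt_pos.2 (by positivity)
  have ht2 : t ^ 2 = (S + 1) / δ := Real.sq_sqrt (by positivity)
  set C₀ : ℝ := (2 * M + 1) * √(4 + |Λ| + 6 * t) + 1 with hC₀
  -- The first summand serves the bridge error, the second the extra sample. The absolute value is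
  -- there because M ≥ 0 is known only once a population and a model are given.
  refine ⟨√η * |C₀| + t, by positivity, ?_⟩
  intro P pA pZ qA d F hstar hStr hU _ hb hbd hη hsep m n nW hm hn hnW lam1 lam2 hl1 hl2 hp1 hp2 Q
    hQ1 hQ2 qHat pHat hsol hmeas
  have hM := hbd.nonneg
  have hC₀pos : 0 ≤ C₀ := by positivity
  have hQprob : IsProbabilityMeasure Q := by
    constructor
    have h1 : (Q.map Prod.fst) Set.univ = 1 := by rw [hQ1]; exact measure_univ
    rwa [Measure.map_apply measurable_fst MeasurableSet.univ] at h1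
  set ρ : Measure (Fin nW → 𝒲) := Measure.pi fun _ => P.lawW
  -- the exceptional events
  set E₁ : Set (Fin m → 𝒲 × 𝒜 × 𝒵) := {s | ¬ (0 ≤ DFPV.empRademacher F.class1 s ∧ ∀ h ∈ F.class1,
    |∫ x, h x ∂P.lawWAZ - (m : ℝ)⁻¹ * ∑ i, h (s i)|
      ≤ 2 * DFPV.empRademacher F.class1 s + 3 * t / √m)} with hE₁
  set E₂ : Set (Fin n → ℝ × 𝒜 × 𝒵) := {s | ¬ (0 ≤ DFPV.empRademacher F.class2 s ∧ ∀ h ∈ F.class2,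
    |∫ x, h x ∂P.lawYAZ - (n : ℝ)⁻¹ * ∑ i, h (s i)|
      ≤ 2 * DFPV.empRademacher F.class2 s + 3 * t / √n)} with hE₂
  have hP₁ : (Measure.pi fun _ => P.lawWAZ) E₁ ≤ ENNReal.ofReal (16 * B₁ ^ 2 / t ^ 2) := by
    obtain ⟨D, hD, hDc, hDm, hDd⟩ := F.exists_dense_class1 hsep
    exact DFPV.measure_uniform_deviation_le hm hD hDc hDd hDm MeasurableSet.univ (by simp)
      (fun h hh x _ => hbd.abs_loss1_le hh x) ht
  have hP₂ : (Measure.pi fun _ => P.lawYAZ) E₂ ≤ ENNReal.ofReal (16 * B₂ ^ 2 / t ^ 2) := by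
    obtain ⟨D, hD, hDc, hDm, hDd⟩ := hbd.exists_dense_class2 hsep
    exact DFPV.measure_uniform_deviation_le hn hD hDc hDd hDm
      (measurableSet_le (continuous_abs.measurable.comp measurable_fst) measurable_const)
      hbd.lawYAZ_compl (fun h hh x hx => hbd.abs_loss2_le hh x hx) ht
  have hadm : ∀ᵐ s ∂Q, pHat s ∈ F.adm2 := hsol.mono fun s hs => hs.2.1
  have hP₃ := hbd.measure_integral_bridge_sub_fHat_gt_le hnW Q hadm hmeas ht
  set E₃ : Set (((Fin m → 𝒲 × 𝒜 × 𝒵) × (Fin n → ℝ × 𝒜 × 𝒵)) × (Fin nW → 𝒲)) :=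
    {x | ENNReal.ofReal (t / √nW) < eLpNorm (fun a =>
      ∫ w, F.bridge (pHat x.1) a w ∂P.lawW - F.fHat (pHat x.1) x.2 a) 2 P.lawA} with hE₃
  -- Stated for arbitrary sets, since the exceptional events need not be measurable; only the
  -- inequality between preimage and image measure is used.
  have hfst : ∀ T, (Q.prod ρ) (Prod.fst ⁻¹' T) ≤ Q T := fun T =>
    (Measure.le_map_apply measurable_fst.aemeasurable T).trans_eq
      (by rw [measurePreserving_fst.map_eq])
  have hQ₁ : (Q.prod ρ) (Prod.fst ⁻¹' (Prod.fst ⁻¹' E₁)) ≤ ENNReal.ofReal (16 * B₁ ^ 2 / t ^ 2) :=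
    (hfst _).trans ((Measure.le_map_apply measurable_fst.aemeasurable E₁).trans (hQ1 ▸ hP₁))
  have hQ₂ : (Q.prod ρ) (Prod.fst ⁻¹' (Prod.snd ⁻¹' E₂)) ≤ ENNReal.ofReal (16 * B₂ ^ 2 / t ^ 2) :=
    (hfst _).trans ((Measure.le_map_apply measurable_snd.aemeasurable E₂).trans (hQ2 ▸ hP₂))
  have hQ₀ : (Q.prod ρ) (Prod.fst ⁻¹' {s | ¬ (F.IsStage1Solution lam1 s.1 (qHat s.1) ∧
      F.IsStage2Solution lam2 s.2 (qHat s.1) (pHat s))}) = 0 :=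
    le_antisymm ((hfst _).trans_eq hsol) zero_le
  have hsum : ENNReal.ofReal (16 * B₁ ^ 2 / t ^ 2) + (ENNReal.ofReal (16 * B₂ ^ 2 / t ^ 2)
      + ENNReal.ofReal (4 * M ^ 4 / t ^ 2)) ≤ ENNReal.ofReal δ := by
    rw [← ENNReal.ofReal_add (by positivity) (by positivity),
      ← ENNReal.ofReal_add (by positivity) (by positivity)]
    refine ENNReal.ofReal_le_ofReal ?_
    have : 16 * B₁ ^ 2 / t ^ 2 + (16 * B₂ ^ 2 / t ^ 2 + 4 * M ^ 4 / t ^ 2) = S / (S + 1) * δ := by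
      rw [ht2, hS]
      field_simp
      ring
    rw [this]
    have : S / (S + 1) ≤ 1 := (div_le_one (by positivity)).2 (by linarith)
    nlinarith
  refine le_trans ?_ ((add_le_add hQ₀.le hsum).trans_eq (zero_add _))
  refine (measure_mono fun x hx => ?_).trans ((measure_union_le _ _).trans (add_le_add le_rfl
    ((measure_union_le _ _).trans (add_le_add hQ₁
      ((measure_union_le _ _).trans (add_le_add hQ₂ hP₃))))))
  by_contra hgood
  simp only [Set.mem_union, Set.mem_preimage, Set.mem_ofPred_eq, not_or, not_not, not_lt, hE₁, hE₂,
    hE₃] at hgood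
  obtain ⟨⟨hs1, hs2⟩, ⟨hR₁, hdev₁⟩, ⟨hR₂, hdev₂⟩, hextra⟩ := hgood
  rw [Set.mem_ofPred_eq, ← not_le] at hx
  refine hx ?_
  set R₁ := DFPV.empRademacher F.class1 x.1.1
  set R₂ := DFPV.empRademacher F.class2 x.1.2
  have hp := hs2.1
  have hm' : (0 : ℝ) < m := by exact_mod_cast hm
  have hκ₁ : 0 ≤ F.kappa1 P := DFPV.Model.BoundedBy.kappa1_nonneg
  have hκ₂ : 0 ≤ F.kappa2 P := DFPV.Model.BoundedBy.kappa2_nonneg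
  set r := √(F.kappa1 P + R₁ + 1 / √m) + F.kappa2 P + √(R₂ + 1 / √n)
  -- Strict positivity, due to the term 1/√m, makes the right side infinite when τ = ∞; otherwise ∞
  -- · 0 = 0 could occur.
  have hr : 0 < r := by
    have : 0 < √(F.kappa1 P + R₁ + 1 / √m) := Real.sqrt_pos.2 (by positivity)
    positivity
  have hC : 0 < √η * |C₀| + t := by positivity
  rcases eq_or_ne (F.illPosedness P hstar) ∞ with hτ | hτ
  · rw [hτ, ENNReal.top_mul (by simpa using hr), top_add,
      ENNReal.mul_top (by simpa using hC)]
    exact le_top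
  have hrisk : √(∫ ω, (P.condAZ P.Y ω
      - P.condAZ (fun ω' => F.bridge (pHat x.1) (P.A ω') (P.W ω')) ω) ^ 2 ∂P.μ) ≤ C₀ * r := by
    refine (hbd.sqrt_integral_condAZ_sub_le hl1 hl2 hp1 hp2 hs1 hs2 hdev₁ hdev₂).trans ?_
    have := DFPV.risk_bound_le (Λ := Λ) (a := 1 / √m) (b := 1 / √n) hM ht.le hκ₁ hκ₂ hR₁ hR₂
      (by positivity) (by positivity)
    simpa only [mul_one_div] using this
  calc eLpNorm (fun a => P.fStruct a - F.fHat (pHat x.1) x.2 a) 2 P.lawA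
      ≤ ENNReal.ofReal √η * (F.illPosedness P hstar * ENNReal.ofReal (C₀ * r))
          + ENNReal.ofReal (t / √nW) := by
        refine (hbd.eLpNorm_fStruct_sub_le hStr hU hb hη hp x.2).trans (add_le_add ?_ hextra)
        refine mul_le_mul_right ((hbd.eLpNorm_bridge_sub_le hb hτ hp).trans ?_) _
        exact mul_le_mul_right (ENNReal.ofReal_le_ofReal hrisk) _
    _ = ENNReal.ofReal (√η * |C₀|) * (F.illPosedness P hstar * ENNReal.ofReal r)
          + ENNReal.ofReal t * ENNReal.ofReal (1 / √nW) := by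
        rw [abs_of_nonneg hC₀pos, ENNReal.ofReal_mul hC₀pos, ENNReal.ofReal_mul (Real.sqrt_nonneg _),
          ← ENNReal.ofReal_mul ht.le, mul_one_div]
        ring
    _ ≤ _ := by
        rw [mul_add]
        refine add_le_add ?_ ?_
        · exact mul_le_mul_left (ENNReal.ofReal_le_ofReal (by linarith)) _
        · refine mul_le_mul_left (ENNReal.ofReal_le_ofReal ?_) _
          have : 0 ≤ √η * |C₀| := by positivity
          linarith
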